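/- Let $q$ be a prime power, $A=\mathbb F_q[\theta]$, $K=\mathbb F_q(\theta)$, and write $x^{(m)}=x^{q^m}$ for $x\in K$ (entrywise for matrices and vectors). For a $t$-module $E$ of dimension $\ell$ over $K$, i.e. an $\mathbb F_q$-algebra homomorphism $\mathbb F_q[t]\to \mathrm{Mat}_\ell(K)[\tau]$, $a\mapsto E_a$ (with $\tau B=B^{(1)}\tau$), such that the constant coefficient $\partial E_t$ of $E_t$ differs from $\theta I_\ell$ by a nilpotent matrix, let $\mathrm{Exp}_E\in \mathrm{Mat}_\ell(K)[[\tau]]$ be the unique series with constant coefficient $I_\ell$ and $\mathrm{Exp}_E\,\partial E_a=E_a\,\mathrm{Exp}_E$ for all $a\in\mathbb F_q[t]$, let $\mathrm{Log}_E=\mathrm{Exp}_E^{-1}=\sum_{m\ge0}C_m\tau^m$, and regard it as the vector of formal power series $\mathrm{Log}_E(\mathbf z)=\sum_{m\ge0} C_m\mathbf z^{(m)}\in K[[\mathbf z]]^\ell$, where $\mathbf z=(z_1,\dots,z_\ell)^{\mathsf T}$ and $\mathbf z^{(m)}=(z_1^{q^m},\dots,z_\ell^{q^m})^{\mathsf T}$.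 Let $\phi$ be the Drinfeld module $\phi_t=\theta+\kappa_1\tau+\kappa_2\tau^2$ with $\kappa_1\in A$ and $\kappa_2\in\mathbb F_q^\times$, and let $\phi^{\otimes2}$, $\mathrm{Sym}^2\phi$ (for odd $q$) and $\mathrm{Alt}^2\phi$ be the $t$-modules given by $$(\phi^{\otimes 2})_t=\begin{pmatrix}\theta&0&\kappa_1&\kappa_2\\ \kappa_1\tau&\theta&\kappa_2\tau&0\\ \kappa_1\tau&\kappa_2\tau&\theta&0\\ \kappa_2\tau^2&0&\kappa_1\tau&\theta\end{pmatrix},\quad (\mathrm{Sym}^2\phi)_t=\begin{pmatrix}\theta&\kappa_1&\kappa_2\\ \kappa_1\tau&\theta+\kappa_2\tau&0\\ \kappa_2\tau^2&\kappa_1\tau&\theta\end{pmatrix},\quad (\mathrm{Alt}^2\phi)_t=\theta-\kappa_2\tau .$$ Write $\mathrm{Log}_\phi(z)=\sum_{m\ge0}\beta_mz^{q^m}$. Let $\mathcal B_m(t)\in K(t)$ be the rational functions of El-Guindy and Papanikolas, $$\mathcal B_m(t)=\sum_{(S_1,S_2)}\ \prod_{j\in S_1}\frac{\kappa_1^{(j)}}{t-\theta^{(j+1)}}\prod_{j\in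 S_2}\frac{\kappa_2}{t-\theta^{(j+2)}}\qquad(m\ge0),\qquad \mathcal B_m(t)=0\quad (m<0),$$ where $(S_1,S_2)$ runs over the pairs of sets for which $S_1$, $S_2$, $S_2+1$ are pairwise disjoint with union $\{0,\dots,m-1\}$; equivalently, $\mathcal B_0=1$ and $\mathcal B_m=\frac{\kappa_1^{(m-1)}}{t-\theta^{(m)}}\mathcal B_{m-1}+\frac{\kappa_2}{t-\theta^{(m)}}\mathcal B_{m-2}$ for $m\ge1$. Let $\mathcal B_m^{(1)}$ be obtained from $\mathcal B_m$ by raising its coefficients in $K$ to the $q$-th power (fixing $t$), and put $\tilde\beta_m=\mathcal B_m^{(1)}(t)|_{t=\theta}$ and $\beta'_m=\partial_t(\mathcal B_m(t))|_{t=\theta}$. For $m\ge1$ put $$L_{1,m}=\beta_m^2,\quad L_{2,m}=\beta_m\beta_{m-1},\quad L'_{1,m}=2\beta_m\beta'_m,\quad L'_{2,m}=\beta'_m\beta_{m-1}+\beta_m\beta'_{m-1},$$ $$\widetilde L_{0,m}=\tfrac{\kappa_2}{\theta-\theta^{(1)}}(\beta_m\tilde\beta_{m-2}-\beta_{m-1}\tilde\beta_{m-1}),\quad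 \widetilde L_{1,m}=\tfrac{\kappa_2}{\theta-\theta^{(1)}}\beta_m\tilde\beta_{m-1},\quad \widetilde L_{2,m}=\tfrac{\kappa_2}{\theta-\theta^{(1)}}\beta_{m-1}\tilde\beta_{m-1},$$ let $\widetilde L_0(z)=\sum_{m\ge1}\widetilde L_{0,m}z^{q^m}$, and let $$\mathbf L_m=\begin{pmatrix} L_{1,m}+(\theta-\theta^{(m)})L'_{1,m}& \kappa_2L'_{2,m}& \kappa_1^{(m)}L'_{1,m}+\kappa_2L'_{2,m}& \kappa_2L'_{1,m}\\ \frac{\theta-\theta^{(m)}}{\kappa_2}\widetilde L_{1,m}& \widetilde L_{0,m}+\widetilde L_{2,m}& \frac{\kappa_1^{(m)}}{\kappa_2}\widetilde L_{1,m}+\widetilde L_{2,m}& \widetilde L_{1,m}\\ \frac{\theta-\theta^{(m)}}{\kappa_2}\widetilde L_{1,m}& \widetilde L_{2,m}& \widetilde L_{0,m}+\frac{\kappa_1^{(m)}}{\kappa_2}\widetilde L_{1,m}+\widetilde L_{2,m}& \widetilde L_{1,m}\\ \frac{\theta-\theta^{(m)}}{\kappa_2}L_{1,m}& L_{2,m}&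 \frac{\kappa_1^{(m)}}{\kappa_2}L_{1,m}+L_{2,m}& L_{1,m} \end{pmatrix}\in \mathrm{Mat}_4(K).$$ Then the following identities of formal power series over $K$ hold. (a) $$\mathrm{Log}_{\phi^{\otimes 2}}\begin{pmatrix}z_1\\z_2\\z_3\\z_4\end{pmatrix}=\begin{pmatrix}z_1\\z_2\\z_3\\z_4\end{pmatrix}+\begin{pmatrix}1&0&0&0\\0&1&0&0\\0&0&1&0\\0&0&-\frac{\kappa_1}{\kappa_2}&1\end{pmatrix}\sum_{m\ge1}\mathbf L_m\begin{pmatrix}z_1^{q^m}\\z_2^{q^m}\\z_3^{q^m}\\z_4^{q^m}\end{pmatrix}.$$ (b) If $q$ is odd, $$\mathrm{Log}_{\mathrm{Sym}^2\phi}\begin{pmatrix}z_1\\z_2\\z_3\end{pmatrix}=\begin{pmatrix}z_1\\z_2\\z_3\end{pmatrix}+\begin{pmatrix}1&0&0&0\\0&\frac12&\frac12&0\\0&-\frac{\kappa_1}{2\kappa_2}&-\frac{\kappa_1}{2\kappa_2}&1\end{pmatrix}\sum_{m\ge1}\mathbf L_m\begin{pmatrix}z_1^{q^m}\\z_2^{q^m}\\z_2^{q^m}\\z_3^{q^m}\end{pmatrix}.$$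 (c) $\mathrm{Log}_{\mathrm{Alt}^2\phi}(z)=z+\widetilde L_0(z)$. -/

import Mathlib

open scoped Polynomial

noncomputable section

/-! ### Twisted power series -/

/-- The twisted power series `∑ b_m τ^m` with coefficients in an `F`-algebra `R`, where `σ` is the
`F`-algebra endomorphism of `R` with `τ b = σ(b) τ`. -/
@[ext]
structure TwistedPowerSeries {F R : Type*} [Field F] [Ring R] [Algebra F R] (σ : R →ₐ[F] R) where
  /-- The coefficient of `τ^m`. -/
  coeff : ℕ → R

namespace TwistedPowerSeries

variable {F R : Type*} [Field F] [Ring R] [Algebra F R] {σ : R →ₐ[F] R}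

instance : Zero (TwistedPowerSeries σ) := ⟨⟨fun _ => 0⟩⟩
instance : One (TwistedPowerSeries σ) := ⟨⟨fun m => if m = 0 then 1 else 0⟩⟩
instance : Add (TwistedPowerSeries σ) := ⟨fun f g => ⟨fun m => f.coeff m + g.coeff m⟩⟩
instance : Neg (TwistedPowerSeries σ) := ⟨fun f => ⟨fun m => -f.coeff m⟩⟩
instance : SMul F (TwistedPowerSeries σ) := ⟨fun c f => ⟨fun m => c • f.coeff m⟩⟩

/-- `(a τ^i) (b τ^j) = a σ^i(b) τ^(i+j)`. -/
instance : Mul (TwistedPowerSeries σ) :=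
  ⟨fun f g => ⟨fun m => ∑ p ∈ Finset.HasAntidiagonal.antidiagonal m, f.coeff p.1 * (σ ^ p.1) (g.coeff p.2)⟩⟩

@[simp] theorem coeff_zero' (m : ℕ) : (0 : TwistedPowerSeries σ).coeff m = 0 := rfl
theorem coeff_one' (m : ℕ) : (1 : TwistedPowerSeries σ).coeff m = if m = 0 then 1 else 0 := rfl
@[simp] theorem coeff_add (f g : TwistedPowerSeries σ) (m : ℕ) :
    (f + g).coeff m = f.coeff m + g.coeff m := rfl
@[simp] theorem coeff_neg (f : TwistedPowerSeries σ) (m : ℕ) : (-f).coeff m = -f.coeff m := rfl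
@[simp] theorem coeff_smul (c : F) (f : TwistedPowerSeries σ) (m : ℕ) :
    (c • f).coeff m = c • f.coeff m := rfl
theorem coeff_mul (f g : TwistedPowerSeries σ) (m : ℕ) :
    (f * g).coeff m =
      ∑ p ∈ Finset.HasAntidiagonal.antidiagonal m, f.coeff p.1 * (σ ^ p.1) (g.coeff p.2) := rfl

/-- The constant series `b = b τ^0`. -/
def const (b : R) : TwistedPowerSeries σ := ⟨fun m => if m = 0 then b else 0⟩

theorem coeff_const (b : R) (m : ℕ) :
    (const b : TwistedPowerSeries σ).coeff m = if m = 0 then b else 0 := rfl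

theorem coeff_const_mul (b : R) (f : TwistedPowerSeries σ) (m : ℕ) :
    (const b * f).coeff m = b * f.coeff m := by
  rw [coeff_mul, Finset.sum_eq_single (0, m)]
  · simp [coeff_const]
  · rintro ⟨i, j⟩ hp hne
    have : i ≠ 0 := by
      rintro rfl
      simp at hp
      exact hne (by rw [hp])
    simp [coeff_const, this]
  · simp

theorem coeff_mul_const (f : TwistedPowerSeries σ) (b : R) (m : ℕ) :
    (f * const b).coeff m = f.coeff m * (σ ^ m) b := by
  rw [coeff_mul, Finset.sum_eq_single (m, 0)]
  · simp [coeff_const]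
  · rintro ⟨i, j⟩ hp hne
    have : j ≠ 0 := by
      rintro rfl
      simp at hp
      exact hne (by rw [hp])
    simp [coeff_const, this]
  · simp

theorem one_eq_const : (1 : TwistedPowerSeries σ) = const 1 := rfl

theorem mul_assoc' (f g h : TwistedPowerSeries σ) : f * g * h = f * (g * h) := by
  ext m
  simp only [coeff_mul, Finset.sum_mul, Finset.mul_sum, map_sum, Finset.sum_sigma']
  refine Finset.sum_nbij' (fun ⟨⟨_i, j⟩, ⟨k, l⟩⟩ => ⟨(k, l + j), (l, j)⟩)
    (fun ⟨⟨i, _j⟩, ⟨k, l⟩⟩ => ⟨(i + k, l), (i, k)⟩) ?_ ?_ ?_ ?_ ?_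
  · rintro ⟨⟨i, j⟩, ⟨k, l⟩⟩ hp
    simp at hp ⊢
    omega
  · rintro ⟨⟨i, j⟩, ⟨k, l⟩⟩ hp
    simp at hp ⊢
    omega
  · rintro ⟨⟨i, j⟩, ⟨k, l⟩⟩ hp
    simp at hp ⊢
    omega
  · rintro ⟨⟨i, j⟩, ⟨k, l⟩⟩ hp
    simp at hp ⊢
    omega
  · rintro ⟨⟨i, j⟩, ⟨k, l⟩⟩ hp
    simp at hp
    obtain ⟨-, rfl⟩ := hp
    simp [pow_add, mul_assoc]

instance : Ring (TwistedPowerSeries σ) where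
  add_assoc f g h := by ext m; simp [add_assoc]
  zero_add f := by ext m; simp
  add_zero f := by ext m; simp
  add_comm f g := by ext m; simp [add_comm]
  neg_add_cancel f := by ext m; simp
  nsmul := nsmulRec
  zsmul := zsmulRec
  mul_assoc := mul_assoc'
  one_mul f := by ext m; rw [one_eq_const, coeff_const_mul, one_mul]
  mul_one f := by ext m; rw [one_eq_const, coeff_mul_const, map_one, mul_one]
  zero_mul f := by ext m; simp [coeff_mul]
  mul_zero f := by ext m; simp [coeff_mul]
  left_distrib f g h := by ext m; simp [coeff_mul, mul_add, Finset.sum_add_distrib]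
  right_distrib f g h := by ext m; simp [coeff_mul, add_mul, Finset.sum_add_distrib]

/-- The constant series, as a ring homomorphism. -/
def constHom : R →+* TwistedPowerSeries σ where
  toFun := const
  map_one' := rfl
  map_mul' a b := by
    ext m
    rw [coeff_const_mul, coeff_const, coeff_const]
    split_ifs <;> simp
  map_zero' := by ext m; simp [coeff_const]
  map_add' a b := by
    ext m
    rw [coeff_add, coeff_const, coeff_const, coeff_const]
    split_ifs <;> simp

instance : Algebra F (TwistedPowerSeries σ) where
  algebraMap := constHom.comp (algebraMap F R)
  commutes' c f := by
    ext m
    change (const _ * f).coeff m = (f * const _).coeff m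
    rw [coeff_const_mul, coeff_mul_const, AlgHom.commutes, Algebra.commutes]
  smul_def' c f := by
    ext m
    change c • f.coeff m = (const _ * f).coeff m
    rw [coeff_const_mul, Algebra.smul_def]

theorem algebraMap_eq (c : F) :
    algebraMap F (TwistedPowerSeries σ) c = const (algebraMap F R c) := rfl

/-- `∂`: the coefficient of `τ^0`. -/
def partialHom : TwistedPowerSeries σ →ₐ[F] R where
  toFun f := f.coeff 0
  map_one' := by simp [coeff_one']
  map_mul' f g := by simp [coeff_mul]
  map_zero' := rfl
  map_add' _ _ := rfl
  commutes' c := by simp [algebraMap_eq, coeff_const]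

theorem partialHom_apply (f : TwistedPowerSeries σ) : partialHom f = f.coeff 0 := rfl

/-- The twisted polynomials `R[τ]`, as a subalgebra of the twisted power series. -/
def polynomials (σ : R →ₐ[F] R) : Subalgebra F (TwistedPowerSeries σ) where
  carrier := {f | ∃ d, ∀ m, d ≤ m → f.coeff m = 0}
  mul_mem' := by
    rintro f g ⟨d, hd⟩ ⟨e, he⟩
    refine ⟨d + e, fun m hm => ?_⟩
    rw [coeff_mul]
    refine Finset.sum_eq_zero fun p hp => ?_
    rw [Finset.HasAntidiagonal.mem_antidiagonal] at hp
    rcases le_or_gt d p.1 with h | h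
    · rw [hd _ h, zero_mul]
    · rw [he _ (by omega), map_zero, mul_zero]
  add_mem' := by
    rintro f g ⟨d, hd⟩ ⟨e, he⟩
    exact ⟨d + e, fun m hm => by rw [coeff_add, hd _ (by omega), he _ (by omega), add_zero]⟩
  algebraMap_mem' c :=
    ⟨1, fun m hm => by rw [algebraMap_eq, coeff_const, if_neg (by omega)]⟩

/-- The twisted polynomial `B₀ + B₁ τ + B₂ τ²`. -/
def quadratic (B₀ B₁ B₂ : R) : polynomials σ :=
  ⟨⟨fun m => match m with
    | 0 => B₀
    | 1 => B₁
    | 2 => B₂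
    | _ => 0⟩, 3, fun m hm => by
      obtain ⟨k, rfl⟩ := Nat.exists_eq_add_of_le' hm
      rfl⟩

theorem exists_strongRec {S : Type*} [Zero S] (Φ : ℕ → (ℕ → S) → S) :
    ∃ g : ℕ → S, ∀ m, g m = Φ m (fun k => if k < m then g k else 0) := by
  refine ⟨fun m => Nat.strongRec (motive := fun _ => S)
    (fun m ih => Φ m (fun k => if h : k < m then ih k h else 0)) m, fun m => ?_⟩
  dsimp only
  rw [Nat.strongRec_eq]
  congr 1

theorem exists_mul_eq_one (f : TwistedPowerSeries σ) (hf : f.coeff 0 = 1) :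
    ∃ g : TwistedPowerSeries σ, g.coeff 0 = 1 ∧ f * g = 1 := by
  obtain ⟨g, hg⟩ := exists_strongRec (S := R) (fun m g => match m with
    | 0 => 1
    | m + 1 => -∑ p ∈ Finset.HasAntidiagonal.antidiagonal m, f.coeff (p.1 + 1) * (σ ^ (p.1 + 1)) (g p.2))
  refine ⟨⟨g⟩, hg 0, ?_⟩
  ext m
  cases m with
  | zero => simp [coeff_mul, hf, hg 0, coeff_one']
  | succ m =>
    rw [coeff_mul, Finset.Nat.sum_antidiagonal_succ]
    simp only [hf, pow_zero, one_mul, AlgHom.one_apply]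
    rw [hg (m + 1)]
    have : ∀ p ∈ Finset.HasAntidiagonal.antidiagonal m,
        f.coeff (p.1 + 1) * (σ ^ (p.1 + 1)) (if p.2 < m + 1 then g p.2 else 0) =
          f.coeff (p.1 + 1) * (σ ^ (p.1 + 1)) (g p.2) := by
      intro p hp
      rw [Finset.HasAntidiagonal.mem_antidiagonal] at hp
      rw [if_pos (by omega)]
    simp only []
    rw [Finset.sum_congr rfl this]
    simp [coeff_one']

theorem isUnit_of_coeff_zero (f : TwistedPowerSeries σ) (hf : f.coeff 0 = 1) : IsUnit f := by
  obtain ⟨g, hg, hfg⟩ := exists_mul_eq_one f hf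
  obtain ⟨h, -, hgh⟩ := exists_mul_eq_one g hg
  have : f = h := by
    calc f = f * (g * h) := by rw [hgh, mul_one]
      _ = h := by rw [← mul_assoc, hfg, one_mul]
  exact ⟨⟨f, g, hfg, by rw [this, hgh]⟩, rfl⟩

end TwistedPowerSeries

/-! ### Anderson `t`-modules over `K = F_q(θ)`, their exponential and logarithm series -/

/-- The element `θ` of `K = F_q(θ)`. -/
abbrev theta (F : Type*) [Field F] : RatFunc F := RatFunc.X

/-- The entrywise `q`-power Frobenius `B ↦ B^(1)` on square matrices over `K = F_q(θ)`. -/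
abbrev matrixFrobenius (F : Type*) [Field F] [Fintype F] (n : Type*) [Fintype n] [DecidableEq n] :
    Matrix n n (RatFunc F) →ₐ[F] Matrix n n (RatFunc F) :=
  (FiniteField.frobeniusAlgHom F (RatFunc F)).mapMatrix

/-- An Anderson `t`-module over `K = F_q(θ)`: an `F_q`-algebra homomorphism
`ψ : F_q[t] → Mat_n(K)[τ]` such that `∂ψ_t - θ` is nilpotent. -/
structure TModule (F : Type*) [Field F] [Fintype F] (n : Type*) [Fintype n] [DecidableEq n] where
  /-- The homomorphism `a ↦ ψ_a`. -/
  toAlgHom : F[X] →ₐ[F] TwistedPowerSeries.polynomials (matrixFrobenius F n)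
  /-- The matrix `∂ψ_t - θ` is nilpotent. -/
  nilpotent : IsNilpotent ((toAlgHom Polynomial.X).1.coeff 0 - Matrix.scalar n (theta F))

namespace TModule

variable {F : Type*} [Field F] [Fintype F] {n : Type*} [Fintype n] [DecidableEq n]

/-- `ψ_a`, as an element of `Mat_n(K)[[τ]]`. -/
def act (E : TModule F n) (a : F[X]) : TwistedPowerSeries (matrixFrobenius F n) :=
  (E.toAlgHom a).1

/-- The constant series `∂ψ_a`. -/
def lie (E : TModule F n) (a : F[X]) : TwistedPowerSeries (matrixFrobenius F n) :=
  TwistedPowerSeries.const ((E.act a).coeff 0)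

/-- The `t`-module with `ψ_t = B₀ + B₁ τ + B₂ τ²`. -/
def ofQuadratic (B₀ B₁ B₂ : Matrix n n (RatFunc F))
    (h : IsNilpotent (B₀ - Matrix.scalar n (theta F))) : TModule F n where
  toAlgHom := Polynomial.aeval (TwistedPowerSeries.quadratic B₀ B₁ B₂)
  nilpotent := by rw [Polynomial.aeval_X]; exact h

/-- `e` is an exponential series of `ψ`: its constant coefficient is the identity matrix, and
`e ∂ψ_a = ψ_a e` for all `a ∈ F_q[t]`. -/
def IsExp (E : TModule F n) (e : TwistedPowerSeries (matrixFrobenius F n)) : Prop :=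
  e.coeff 0 = 1 ∧ ∀ a : F[X], e * E.lie a = E.act a * e

theorem theta_pow_ne (F : Type*) [Field F] [Fintype F] (m : ℕ) :
    theta F ^ Fintype.card F ^ (m + 1) - theta F ≠ 0 := by
  intro h
  have h1 : (algebraMap F[X] (RatFunc F)) (Polynomial.X ^ Fintype.card F ^ (m + 1)) =
      algebraMap F[X] (RatFunc F) Polynomial.X := by
    rw [map_pow, RatFunc.algebraMap_X]
    exact sub_eq_zero.mp h
  have h2 := congrArg Polynomial.natDegree (RatFunc.algebraMap_injective F h1)
  rw [Polynomial.natDegree_X_pow, Polynomial.natDegree_X] at h2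
  have := Nat.one_lt_pow (show m + 1 ≠ 0 by omega) (Fintype.one_lt_card (α := F))
  omega

theorem matrixFrobenius_pow_apply (m : ℕ) (B : Matrix n n (RatFunc F)) :
    (matrixFrobenius F n ^ m) B = B.map (fun x => x ^ Fintype.card F ^ m) := by
  induction m generalizing B with
  | zero => simp
  | succ m ih =>
    rw [pow_succ, AlgHom.mul_apply, ih]
    ext i j
    simp [← pow_mul, pow_succ, mul_comm]

theorem sylvester_bijective {D : Matrix n n (RatFunc F)}
    (hD : IsNilpotent (D - Matrix.scalar n (theta F))) (m : ℕ) :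
    Function.Bijective (fun B : Matrix n n (RatFunc F) =>
      B * (matrixFrobenius F n ^ (m + 1)) D - D * B) := by
  set N := D - Matrix.scalar n (theta F) with hN
  have hDN : D = Matrix.scalar n (theta F) + N := by rw [hN]; abel
  have hs : (matrixFrobenius F n ^ (m + 1)) D =
      Matrix.scalar n (theta F ^ Fintype.card F ^ (m + 1)) + (matrixFrobenius F n ^ (m + 1)) N := by
    rw [hDN, map_add, matrixFrobenius_pow_apply]
    congr 1
    ext i j
    by_cases h : i = j
    · simp [h]
    · simp [h]
  set N' := (matrixFrobenius F n ^ (m + 1)) N with hN'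
  have hnil' : IsNilpotent N' := hD.map _
  have hu : IsUnit (algebraMap (RatFunc F) (Module.End (RatFunc F) (Matrix n n (RatFunc F)))
      (theta F ^ Fintype.card F ^ (m + 1) - theta F)) :=
    (isUnit_iff_ne_zero.mpr (theta_pow_ne F m)).map _
  have hc : Commute (LinearMap.mulRight (RatFunc F) N') (LinearMap.mulLeft (RatFunc F) N) :=
    (LinearMap.commute_mulLeft_right N N').symm
  have hn : IsNilpotent (LinearMap.mulRight (RatFunc F) N' - LinearMap.mulLeft (RatFunc F) N) :=
    hc.isNilpotent_sub ((LinearMap.isNilpotent_mulRight_iff _ _).mpr hnil')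
      ((LinearMap.isNilpotent_mulLeft_iff _ _).mpr hD)
  have key := hn.isUnit_add_left_of_commute hu (Algebra.commutes _ _).symm
  rw [Module.End.isUnit_iff] at key
  convert key using 1
  funext B
  rw [hs]
  simp only [LinearMap.add_apply, LinearMap.sub_apply, LinearMap.mulRight_apply,
    LinearMap.mulLeft_apply, Module.algebraMap_end_apply, mul_add]
  conv_lhs => rw [hDN, add_mul]
  have h1 : B * Matrix.scalar n (theta F ^ Fintype.card F ^ (m + 1)) =
      theta F ^ Fintype.card F ^ (m + 1) • B := by
    rw [Matrix.scalar_apply, ← Matrix.smul_one_eq_diagonal, Matrix.mul_smul, mul_one]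
  have h2 : Matrix.scalar n (theta F) * B = theta F • B := by
    rw [Matrix.scalar_apply, ← Matrix.smul_one_eq_diagonal, Matrix.smul_mul, one_mul]
  rw [h1, h2, sub_smul]
  abel

/-- Every `t`-module has exactly one exponential series. -/
theorem existsUnique_isExp (E : TModule F n) : ∃! e, E.IsExp e := by
  have hbij := sylvester_bijective E.nilpotent
  set T := E.act Polynomial.X with hT
  change ∀ m, Function.Bijective (fun B => B * (matrixFrobenius F n ^ (m + 1)) (T.coeff 0) -
    T.coeff 0 * B) at hbij
  have hcoeff : ∀ e : TwistedPowerSeries (matrixFrobenius F n),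
      e * E.lie Polynomial.X = T * e ↔ ∀ m,
        e.coeff (m + 1) * (matrixFrobenius F n ^ (m + 1)) (T.coeff 0) -
          T.coeff 0 * e.coeff (m + 1) = ∑ p ∈ Finset.HasAntidiagonal.antidiagonal m,
            T.coeff (p.1 + 1) * (matrixFrobenius F n ^ (p.1 + 1)) (e.coeff p.2) ∧
        e.coeff 0 * T.coeff 0 = T.coeff 0 * e.coeff 0 := by
    intro e
    rw [TwistedPowerSeries.ext_iff, funext_iff]
    constructor
    · intro h m
      constructor
      · have := h (m + 1)
        rw [lie, TwistedPowerSeries.coeff_mul_const, TwistedPowerSeries.coeff_mul,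
          Finset.Nat.sum_antidiagonal_succ] at this
        rw [← hT] at this
        rw [this]
        simp
      · have := h 0
        rw [lie, TwistedPowerSeries.coeff_mul_const, TwistedPowerSeries.coeff_mul] at this
        simpa using this
    · intro h m
      rw [lie, TwistedPowerSeries.coeff_mul_const, TwistedPowerSeries.coeff_mul, ← hT]
      cases m with
      | zero => simpa using (h 0).2
      | succ m =>
        rw [Finset.Nat.sum_antidiagonal_succ, ← (h m).1]
        simp
  have hall : ∀ e : TwistedPowerSeries (matrixFrobenius F n),
      e * E.lie Polynomial.X = T * e → ∀ a, e * E.lie a = E.act a * e := by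
    intro e he a
    have hadd : ∀ a b, E.act (a + b) = E.act a + E.act b := fun a b => by
      simp [act]
    have hmul : ∀ a b, E.act (a * b) = E.act a * E.act b := fun a b => by
      simp [act]
    have ladd : ∀ a b, E.lie (a + b) = E.lie a + E.lie b := fun a b => by
      simp only [lie, hadd, TwistedPowerSeries.coeff_add]
      exact map_add TwistedPowerSeries.constHom _ _
    have lmul : ∀ a b, E.lie (a * b) = E.lie a * E.lie b := fun a b => by
      simp only [lie, hmul]
      rw [← TwistedPowerSeries.partialHom_apply, map_mul]
      exact map_mul TwistedPowerSeries.constHom _ _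
    have hC : ∀ c, e * E.lie (Polynomial.C c) = E.act (Polynomial.C c) * e := by
      intro c
      have h1 : E.act (Polynomial.C c) = algebraMap F _ c := by
        rw [act, ← Polynomial.algebraMap_eq, AlgHom.commutes]
        rfl
      have h2 : E.lie (Polynomial.C c) = algebraMap F _ c := by
        rw [lie, h1, TwistedPowerSeries.algebraMap_eq, TwistedPowerSeries.coeff_const, if_pos rfl]
      rw [h1, h2, Algebra.commutes]
    induction a using Polynomial.induction_on with
    | C c => exact hC c
    | add p q hp hq => rw [ladd, hadd, mul_add, add_mul, hp, hq]
    | monomial k c ih =>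
      rw [pow_succ, ← mul_assoc, lmul, hmul, ← mul_assoc, ih, mul_assoc, he, mul_assoc]
  have hstep : ∀ m (c : Matrix n n (RatFunc F)), ∃ B : Matrix n n (RatFunc F),
      B * (matrixFrobenius F n ^ (m + 1)) (T.coeff 0) - T.coeff 0 * B = c :=
    fun m c => (hbij m).2 c
  choose S hS using hstep
  obtain ⟨g, hg⟩ := TwistedPowerSeries.exists_strongRec (S := Matrix n n (RatFunc F))
    (fun m g => match m with
    | 0 => 1
    | m + 1 => S m (∑ p ∈ Finset.HasAntidiagonal.antidiagonal m,
        T.coeff (p.1 + 1) * (matrixFrobenius F n ^ (p.1 + 1)) (g p.2)))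
  refine ⟨⟨g⟩, ⟨hg 0, hall _ ((hcoeff _).mpr fun m => ⟨?_, ?_⟩)⟩, ?_⟩
  · simp only []
    rw [hg (m + 1)]
    simp only []
    rw [hS]
    refine Finset.sum_congr rfl fun p hp => ?_
    rw [Finset.HasAntidiagonal.mem_antidiagonal] at hp
    rw [if_pos (by omega)]
  · have : g 0 = 1 := hg 0
    simp [this]
  · rintro f ⟨hf0, hf⟩
    have hf1 := (hcoeff f).mp (hf _)
    ext1
    funext m
    induction m using Nat.strong_induction_on with
    | _ m ih =>
      cases m with
      | zero => rw [hf0]; exact (hg 0).symm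
      | succ m =>
        refine (hbij m).1 ?_
        simp only []
        rw [(hf1 m).1, hg (m + 1)]
        simp only []
        rw [hS]
        refine Finset.sum_congr rfl fun p hp => ?_
        rw [Finset.HasAntidiagonal.mem_antidiagonal] at hp
        rw [if_pos (by omega), ih _ (by omega)]

/-- The exponential series `Exp_ψ ∈ Mat_n(K)[[τ]]`. -/
def exp (E : TModule F n) : TwistedPowerSeries (matrixFrobenius F n) :=
  E.existsUnique_isExp.choose

theorem isExp_exp (E : TModule F n) : E.IsExp E.exp := E.existsUnique_isExp.choose_spec.1

theorem isUnit_exp (E : TModule F n) : IsUnit E.exp :=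
  TwistedPowerSeries.isUnit_of_coeff_zero _ E.isExp_exp.1

/-- The logarithm series `Log_ψ = Exp_ψ⁻¹ ∈ Mat_n(K)[[τ]]`. -/
def log (E : TModule F n) : TwistedPowerSeries (matrixFrobenius F n) :=
  ((E.isUnit_exp.unit⁻¹ : (TwistedPowerSeries (matrixFrobenius F n))ˣ) :
    TwistedPowerSeries (matrixFrobenius F n))

end TModule

/-- The coefficientwise sum `∑_m f_m` of a sequence of formal power series, to be used when every
monomial occurs in only finitely many `f_m`. -/
def formalSum {s R : Type*} [CommSemiring R] (f : ℕ → MvPowerSeries s R) : MvPowerSeries s R :=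
  fun d => ∑ᶠ m, MvPowerSeries.coeff d (f m)

/-- The product `B v` of a matrix of constants and a vector of formal power series. -/
def constMulVec {l k s R : Type*} [Fintype k] [CommSemiring R] (B : Matrix l k R)
    (v : k → MvPowerSeries s R) : l → MvPowerSeries s R :=
  fun i => ∑ j, MvPowerSeries.C (B i j) * v j

/-- The logarithm of `ψ` as a vector of formal power series in `z = (z_j)`: if
`Log_ψ = ∑_m C_m τ^m`, this is `Log_ψ(z) = ∑_m C_m z^(m)` with `z^(m) = (z_j^(q^m))`. -/
def TModule.logFunction {F : Type*} [Field F] [Fintype F] {n : Type*} [Fintype n] [DecidableEq n]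
    (E : TModule F n) : n → MvPowerSeries n (RatFunc F) :=
  fun i => formalSum fun m =>
    constMulVec (E.log.coeff m) (fun j => MvPowerSeries.X j ^ Fintype.card F ^ m) i

/-! ### The Drinfeld module `φ_t = θ + κ₁ τ + κ₂ τ²` and its tensor structures -/

section TensorStructures

variable {F : Type*} [Field F] [Fintype F]

/-- `κ₁ ∈ F_q[θ]` as an element of `K`. -/
abbrev kappaOne (κ₁ : F[X]) : RatFunc F := algebraMap F[X] (RatFunc F) κ₁

/-- `κ₂ ∈ F_q^×` as an element of `K`. -/
abbrev kappaTwo (κ₂ : Fˣ) : RatFunc F := RatFunc.C (κ₂ : F)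

/-- The Drinfeld module `φ` of rank `2` with `φ_t = θ + κ₁ τ + κ₂ τ²`. -/
def drinfeldModule (κ₁ : F[X]) (κ₂ : Fˣ) : TModule F (Fin 1) :=
  TModule.ofQuadratic !![theta F] !![kappaOne κ₁] !![kappaTwo κ₂]
    ⟨1, by ext i j; fin_cases i; fin_cases j; simp⟩

/-- The tensor square `φ^{⊗2}`: the matrix of multiplication by `t` on the `t`-motive
`M_φ ⊗ M_φ` in the `K[τ]`-basis `1 ⊗ 1, 1 ⊗ τ, τ ⊗ 1, τ² ⊗ 1`. -/
def tensorSquare (κ₁ : F[X]) (κ₂ : Fˣ) : TModule F (Fin 4) :=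
  TModule.ofQuadratic
    !![theta F, 0, kappaOne κ₁, kappaTwo κ₂;
       0, theta F, 0, 0;
       0, 0, theta F, 0;
       0, 0, 0, theta F]
    !![0, 0, 0, 0;
       kappaOne κ₁, 0, kappaTwo κ₂, 0;
       kappaOne κ₁, kappaTwo κ₂, 0, 0;
       0, 0, kappaOne κ₁, 0]
    !![0, 0, 0, 0;
       0, 0, 0, 0;
       0, 0, 0, 0;
       kappaTwo κ₂, 0, 0, 0]
    ⟨2, by
      ext i j
      fin_cases i <;> fin_cases j <;> simp [pow_two, Matrix.mul_apply, Fin.sum_univ_succ]⟩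

/-- The symmetric square `Sym² φ` (for odd `q`): the matrix of multiplication by `t` on the
`t`-motive `Sym² M_φ` in the `K[τ]`-basis `1 ⊗ 1, (1 ⊗ τ + τ ⊗ 1)/2, (1 ⊗ τ² + τ² ⊗ 1)/2`. -/
def symmetricSquare (κ₁ : F[X]) (κ₂ : Fˣ) : TModule F (Fin 3) :=
  TModule.ofQuadratic
    !![theta F, kappaOne κ₁, kappaTwo κ₂;
       0, theta F, 0;
       0, 0, theta F]
    !![0, 0, 0;
       kappaOne κ₁, kappaTwo κ₂, 0;
       0, kappaOne κ₁, 0]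
    !![0, 0, 0;
       0, 0, 0;
       kappaTwo κ₂, 0, 0]
    ⟨2, by
      ext i j
      fin_cases i <;> fin_cases j <;> simp [pow_two, Matrix.mul_apply, Fin.sum_univ_succ]⟩

/-- The alternating square `Alt² φ`: the Drinfeld module with `(Alt² φ)_t = θ - κ₂ τ`. -/
def alternatingSquare (κ₂ : Fˣ) : TModule F (Fin 1) :=
  TModule.ofQuadratic !![theta F] !![-kappaTwo κ₂] !![0]
    ⟨1, by ext i j; fin_cases i; fin_cases j; simp⟩

/-! ### The rational functions `𝓑_m(t)` -/

/-- The shadowed partitions of `{0, …, m-1}` of order `2`: pairs `(S₁, S₂)` of finite sets such that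
`S₁`, `S₂` and `S₂ + 1` are pairwise disjoint with union `{0, …, m-1}`. -/
def shadowedPartitions (m : ℕ) : Finset (Finset ℕ × Finset ℕ) :=
  ((Finset.range m).powerset ×ˢ (Finset.range m).powerset).filter fun S =>
    Disjoint S.1 S.2 ∧ Disjoint S.1 (S.2.image (· + 1)) ∧ Disjoint S.2 (S.2.image (· + 1)) ∧
      S.1 ∪ S.2 ∪ S.2.image (· + 1) = Finset.range m

/-- The factor `κ^(q^j) / (t - θ^(q^(i+j)))` in `K(t)`. -/
def shadowFactor (κ : RatFunc F) (i j : ℕ) : RatFunc (RatFunc F) :=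
  RatFunc.C (κ ^ Fintype.card F ^ j) /
    (RatFunc.X - RatFunc.C (theta F ^ Fintype.card F ^ (i + j)))

/-- The rational functions `𝓑_m(t) ∈ K(t)` of El-Guindy and Papanikolas, with `𝓑_m = 0` for
`m < 0`. -/
def ratB (κ₁ : F[X]) (κ₂ : Fˣ) (m : ℤ) : RatFunc (RatFunc F) :=
  if m < 0 then 0 else
    ∑ S ∈ shadowedPartitions m.toNat,
      (∏ j ∈ S.1, shadowFactor (kappaOne κ₁) 1 j) * ∏ j ∈ S.2, shadowFactor (kappaTwo κ₂) 2 j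

theorem mem_shadowedPartitions (m : ℕ) (S : Finset ℕ × Finset ℕ) :
    S ∈ shadowedPartitions m ↔ (∀ x ∈ S.1, x ∉ S.2) ∧ (∀ x ∈ S.2, x + 1 ∉ S.1) ∧
      (∀ x ∈ S.2, x + 1 ∉ S.2) ∧ ∀ x, x < m ↔ x ∈ S.1 ∨ x ∈ S.2 ∨ (1 ≤ x ∧ x - 1 ∈ S.2) := by
  have himg : ∀ x, x ∈ S.2.image (· + 1) ↔ 1 ≤ x ∧ x - 1 ∈ S.2 := by
    intro x
    rw [Finset.mem_image]
    constructor
    · rintro ⟨y, hy, rfl⟩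
      exact ⟨by omega, by simpa using hy⟩
    · rintro ⟨h, hx⟩
      exact ⟨x - 1, hx, by omega⟩
  rw [shadowedPartitions, Finset.mem_filter, Finset.mem_product, Finset.mem_powerset,
    Finset.mem_powerset, Finset.disjoint_left, Finset.disjoint_left, Finset.disjoint_left,
    Finset.ext_iff]
  simp only [Finset.mem_union, himg, Finset.mem_range, Finset.subset_iff]
  constructor
  · rintro ⟨-, h1, h2, h3, h4⟩
    refine ⟨h1, fun x hx hx' => h2 hx' ⟨by omega, by simpa using hx⟩,
      fun x hx hx' => h3 hx' ⟨by omega, by simpa using hx⟩, fun x => ?_⟩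
    rw [← h4 x, or_assoc]
  · rintro ⟨h1, h2, h3, h4⟩
    refine ⟨⟨fun x hx => (h4 x).mpr (Or.inl hx), fun x hx => (h4 x).mpr (Or.inr (Or.inl hx))⟩,
      fun x hx => h1 hx, ?_, ?_, fun x => ?_⟩
    · rintro x hx ⟨h, hx'⟩
      have := h2 _ hx'
      rw [Nat.sub_add_cancel h] at this
      exact this hx
    · rintro x hx ⟨h, hx'⟩
      have := h3 _ hx'
      rw [Nat.sub_add_cancel h] at this
      exact this hx
    · rw [h4 x, or_assoc]

theorem sum_shadowedPartitions {R : Type*} [CommRing R] (a b : ℕ → R) (m : ℕ) :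
    ∑ S ∈ shadowedPartitions (m + 2), (∏ j ∈ S.1, a j) * ∏ j ∈ S.2, b j =
      a (m + 1) * (∑ S ∈ shadowedPartitions (m + 1), (∏ j ∈ S.1, a j) * ∏ j ∈ S.2, b j) +
        b m * ∑ S ∈ shadowedPartitions m, (∏ j ∈ S.1, a j) * ∏ j ∈ S.2, b j := by
  rw [← Finset.sum_filter_add_sum_filter_not _ (fun S : Finset ℕ × Finset ℕ => m + 1 ∈ S.1),
    Finset.mul_sum, Finset.mul_sum]
  congr 1
  · refine Finset.sum_nbij' (fun S => (S.1.erase (m + 1), S.2))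
      (fun S => (insert (m + 1) S.1, S.2)) ?_ ?_ ?_ ?_ ?_
    · intro S hS
      rw [Finset.mem_filter, mem_shadowedPartitions] at hS
      rw [mem_shadowedPartitions]
      obtain ⟨⟨h1, h2, h3, h4⟩, h5⟩ := hS
      simp only [Finset.mem_erase]
      have a1 : m + 1 ∉ S.2 := h1 _ h5
      have a2 : m ∉ S.2 := fun h => h2 _ h h5
      refine ⟨fun x hx => h1 x hx.2, fun x hx h => h2 x hx h.2, h3, fun x => ?_⟩
      have h := h4 x
      clear h1 h2 h3 h4
      rcases eq_or_ne x (m + 1) with rfl | hx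
      · simp [a1, a2]
      · grind
    · intro S hS
      rw [mem_shadowedPartitions] at hS
      rw [Finset.mem_filter, mem_shadowedPartitions]
      obtain ⟨h1, h2, h3, h4⟩ := hS
      simp only [Finset.mem_insert]
      have a1 : m + 1 ∉ S.2 := fun h => by
        have := (h4 (m + 1)).mpr (Or.inr (Or.inl h))
        omega
      have a2 : m ∉ S.2 := fun h => by
        have := (h4 (m + 1)).mpr (Or.inr (Or.inr ⟨by omega, h⟩))
        omega
      refine ⟨⟨?_, ?_, h3, fun x => ?_⟩, by simp⟩
      · rintro x (rfl | hx)
        · exact a1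
        · exact h1 x hx
      · rintro x hx (h | h)
        · exact a2 (by rwa [show m = x by omega])
        · exact h2 x hx h
      · have h := h4 x
        clear h1 h2 h3 h4
        grind
    · intro S hS
      rw [Finset.mem_filter] at hS
      simp only [Finset.insert_erase hS.2]
    · intro S hS
      rw [mem_shadowedPartitions] at hS
      have : m + 1 ∉ S.1 := fun h => by
        have := (hS.2.2.2 (m + 1)).mpr (Or.inl h)
        omega
      simp only [Finset.erase_insert this]
    · intro S hS
      rw [Finset.mem_filter] at hS
      simp only []
      rw [← Finset.mul_prod_erase _ _ hS.2, mul_assoc]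
  · refine Finset.sum_nbij' (fun S => (S.1, S.2.erase m))
      (fun S => (S.1, insert m S.2)) ?_ ?_ ?_ ?_ ?_
    · intro S hS
      rw [Finset.mem_filter, mem_shadowedPartitions] at hS
      rw [mem_shadowedPartitions]
      obtain ⟨⟨h1, h2, h3, h4⟩, h5⟩ := hS
      simp only [Finset.mem_erase]
      have a1 : m + 1 ∉ S.2 := fun h => by
        have := (h4 (m + 2)).mpr (Or.inr (Or.inr ⟨by omega, h⟩))
        omega
      have a2 : m ∈ S.2 := by
        rcases (h4 (m + 1)).mp (by omega) with h | h | h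
        · exact absurd h h5
        · exact absurd h a1
        · exact h.2
      have a3 : m ∉ S.1 := fun h => h1 _ h a2
      refine ⟨fun x hx h => h1 x hx h.2, fun x hx h => h2 x hx.2 h,
        fun x hx h => h3 x hx.2 h.2, fun x => ?_⟩
      have h := h4 x
      have h' := h3 (x - 1)
      clear h1 h2 h3 h4
      rcases eq_or_ne x (m + 1) with rfl | hx
      · simp [a1, h5]
      · rcases eq_or_ne x m with rfl | hx'
        · grind
        · grind
    · intro S hS
      rw [mem_shadowedPartitions] at hS
      rw [Finset.mem_filter, mem_shadowedPartitions]
      obtain ⟨h1, h2, h3, h4⟩ := hS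
      simp only [Finset.mem_insert]
      have a1 : m ∉ S.1 := fun h => by
        have := (h4 m).mpr (Or.inl h)
        omega
      have a2 : m + 1 ∉ S.1 := fun h => by
        have := (h4 (m + 1)).mpr (Or.inl h)
        omega
      have a3 : m + 1 ∉ S.2 := fun h => by
        have := (h4 (m + 1)).mpr (Or.inr (Or.inl h))
        omega
      refine ⟨⟨?_, ?_, ?_, fun x => ?_⟩, a2⟩
      · rintro x hx (rfl | h)
        · exact a1 hx
        · exact h1 x hx h
      · rintro x (rfl | hx) h
        · exact a2 h
        · exact h2 x hx h
      · rintro x (rfl | hx) (h | h)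
        · omega
        · exact a3 h
        · have := (h4 (x + 1)).mpr (Or.inr (Or.inr ⟨by omega, hx⟩))
          omega
        · exact h3 x hx h
      · have h := h4 x
        clear h1 h2 h3 h4
        grind
    · intro S hS
      rw [Finset.mem_filter, mem_shadowedPartitions] at hS
      have : m ∈ S.2 := by
        obtain ⟨⟨h1, h2, h3, h4⟩, h5⟩ := hS
        rcases (h4 (m + 1)).mp (by omega) with h | h | h
        · exact absurd h h5
        · have := (h4 (m + 2)).mpr (Or.inr (Or.inr ⟨by omega, h⟩))
          omega
        · exact h.2
      simp only [Finset.insert_erase this]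
    · intro S hS
      rw [mem_shadowedPartitions] at hS
      have : m ∉ S.2 := fun h => by
        have := (hS.2.2.2 m).mpr (Or.inr (Or.inl h))
        omega
      simp only [Finset.erase_insert this]
    · intro S hS
      rw [Finset.mem_filter, mem_shadowedPartitions] at hS
      have : m ∈ S.2 := by
        obtain ⟨⟨h1, h2, h3, h4⟩, h5⟩ := hS
        rcases (h4 (m + 1)).mp (by omega) with h | h | h
        · exact absurd h h5
        · have := (h4 (m + 2)).mpr (Or.inr (Or.inr ⟨by omega, h⟩))
          omega
        · exact h.2
      simp only []
      rw [← Finset.mul_prod_erase _ _ this]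
      ring

theorem ratB_neg (κ₁ : F[X]) (κ₂ : Fˣ) {m : ℤ} (hm : m < 0) : ratB κ₁ κ₂ m = 0 := if_pos hm

theorem ratB_zero (κ₁ : F[X]) (κ₂ : Fˣ) : ratB κ₁ κ₂ 0 = 1 := by
  have : shadowedPartitions 0 = {(∅, ∅)} := by decide
  simp [ratB, this]

/-- The recurrence satisfied by the `𝓑_m`, which together with `ratB_neg` and `ratB_zero`
determines them. -/
theorem ratB_succ (κ₁ : F[X]) (κ₂ : Fˣ) (m : ℕ) :
    ratB κ₁ κ₂ ((m : ℤ) + 1) =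
      RatFunc.C (kappaOne κ₁ ^ Fintype.card F ^ m) /
          (RatFunc.X - RatFunc.C (theta F ^ Fintype.card F ^ (m + 1))) * ratB κ₁ κ₂ m +
        RatFunc.C (kappaTwo κ₂) /
          (RatFunc.X - RatFunc.C (theta F ^ Fintype.card F ^ (m + 1))) *
            ratB κ₁ κ₂ ((m : ℤ) - 1) := by
  cases m with
  | zero =>
    have h1 : shadowedPartitions 1 = {({0}, ∅)} := by decide
    simp [ratB_neg, ratB_zero]
    simp [ratB, h1, shadowFactor]
  | succ m =>
    have hκ : kappaTwo κ₂ ^ Fintype.card F ^ m = kappaTwo κ₂ := by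
      rw [kappaTwo, ← map_pow, FiniteField.pow_card_pow]
    have e1 : ((m + 1 : ℕ) : ℤ) + 1 = ((m + 2 : ℕ) : ℤ) := by push_cast; ring
    have e2 : ((m + 1 : ℕ) : ℤ) - 1 = (m : ℤ) := by push_cast; ring
    have hB : ∀ k : ℕ, ratB κ₁ κ₂ (k : ℤ) = ∑ S ∈ shadowedPartitions k,
        (∏ j ∈ S.1, shadowFactor (kappaOne κ₁) 1 j) *
          ∏ j ∈ S.2, shadowFactor (kappaTwo κ₂) 2 j := by
      intro k
      rw [ratB, if_neg (by omega), Int.toNat_natCast]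
    rw [e1, e2, hB, hB, hB, sum_shadowedPartitions]
    simp only [shadowFactor, hκ]
    rw [show 1 + (m + 1) = m + 1 + 1 by ring, show 2 + m = m + 1 + 1 by ring]

/-! ### The coefficients in the logarithms -/

/-- The Frobenius twist `f ↦ f^(1)` on `K(t)`: the `q`-power Frobenius on the coefficients in `K`,
fixing `t`. -/
def twist : RatFunc (RatFunc F) →+* RatFunc (RatFunc F) :=
  RatFunc.mapRingHom
    (Polynomial.mapRingHom (FiniteField.frobeniusAlgHom F (RatFunc F)).toRingHom)
    (nonZeroDivisors_le_comap_nonZeroDivisors_of_injective _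
      (Polynomial.map_injective _ (RingHom.injective _)))

/-- The derivative `∂_t` on `K(t)`. -/
def derivT (f : RatFunc (RatFunc F)) : RatFunc (RatFunc F) :=
  algebraMap _ _ (Polynomial.derivative f.num * f.denom - f.num * Polynomial.derivative f.denom) /
    algebraMap _ _ (f.denom ^ 2)

/-- The value `f(t)|_{t=θ}` of `f ∈ K(t)`, provided that `f` has no pole at `t = θ`. -/
def evalTheta (f : RatFunc (RatFunc F)) : RatFunc F :=
  RatFunc.eval (RingHom.id (RatFunc F)) (theta F) f

/-- `β_m`, where `Log_φ(z) = ∑_{m ≥ 0} β_m z^(q^m)`. -/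
def beta (κ₁ : F[X]) (κ₂ : Fˣ) (m : ℤ) : RatFunc F :=
  if m < 0 then 0 else (drinfeldModule κ₁ κ₂).log.coeff m.toNat 0 0

/-- `β̃_m = 𝓑_m^(1)(t)|_{t=θ}`. -/
def betaTilde (κ₁ : F[X]) (κ₂ : Fˣ) (m : ℤ) : RatFunc F := evalTheta (twist (ratB κ₁ κ₂ m))

/-- `β'_m = ∂_t(𝓑_m(t))|_{t=θ}`. -/
def betaPrime (κ₁ : F[X]) (κ₂ : Fˣ) (m : ℤ) : RatFunc F := evalTheta (derivT (ratB κ₁ κ₂ m))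

/-- `L_{1,m}`. -/
def coeffL1 (κ₁ : F[X]) (κ₂ : Fˣ) (m : ℤ) : RatFunc F := beta κ₁ κ₂ m ^ 2

/-- `L_{2,m}`. -/
def coeffL2 (κ₁ : F[X]) (κ₂ : Fˣ) (m : ℤ) : RatFunc F := beta κ₁ κ₂ m * beta κ₁ κ₂ (m - 1)

/-- `L'_{1,m}`. -/
def coeffL1Prime (κ₁ : F[X]) (κ₂ : Fˣ) (m : ℤ) : RatFunc F :=
  2 * beta κ₁ κ₂ m * betaPrime κ₁ κ₂ m

/-- `L'_{2,m}`. -/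
def coeffL2Prime (κ₁ : F[X]) (κ₂ : Fˣ) (m : ℤ) : RatFunc F :=
  betaPrime κ₁ κ₂ m * beta κ₁ κ₂ (m - 1) + beta κ₁ κ₂ m * betaPrime κ₁ κ₂ (m - 1)

/-- `L̃_{0,m}`. -/
def coeffL0Tilde (κ₁ : F[X]) (κ₂ : Fˣ) (m : ℤ) : RatFunc F :=
  kappaTwo κ₂ / (theta F - theta F ^ Fintype.card F) *
    (beta κ₁ κ₂ m * betaTilde κ₁ κ₂ (m - 2) - beta κ₁ κ₂ (m - 1) * betaTilde κ₁ κ₂ (m - 1))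

/-- `L̃_{1,m}`. -/
def coeffL1Tilde (κ₁ : F[X]) (κ₂ : Fˣ) (m : ℤ) : RatFunc F :=
  kappaTwo κ₂ / (theta F - theta F ^ Fintype.card F) *
    (beta κ₁ κ₂ m * betaTilde κ₁ κ₂ (m - 1))

/-- `L̃_{2,m}`. -/
def coeffL2Tilde (κ₁ : F[X]) (κ₂ : Fˣ) (m : ℤ) : RatFunc F :=
  kappaTwo κ₂ / (theta F - theta F ^ Fintype.card F) *
    (beta κ₁ κ₂ (m - 1) * betaTilde κ₁ κ₂ (m - 1))

/-- The matrix `𝐋_m`, for `m ≥ 1`. -/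
def matrixL (κ₁ : F[X]) (κ₂ : Fˣ) (m : ℕ) : Matrix (Fin 4) (Fin 4) (RatFunc F) :=
  let k₂ := kappaTwo κ₂
  let k₁m := kappaOne κ₁ ^ Fintype.card F ^ m
  let δ := theta F - theta F ^ Fintype.card F ^ m
  let L₁ := coeffL1 κ₁ κ₂ m
  let L₂ := coeffL2 κ₁ κ₂ m
  let L₁' := coeffL1Prime κ₁ κ₂ m
  let L₂' := coeffL2Prime κ₁ κ₂ m
  let T₀ := coeffL0Tilde κ₁ κ₂ m
  let T₁ := coeffL1Tilde κ₁ κ₂ m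
  let T₂ := coeffL2Tilde κ₁ κ₂ m
  !![L₁ + δ * L₁', k₂ * L₂', k₁m * L₁' + k₂ * L₂', k₂ * L₁';
     δ / k₂ * T₁, T₀ + T₂, k₁m / k₂ * T₁ + T₂, T₁;
     δ / k₂ * T₁, T₂, T₀ + k₁m / k₂ * T₁ + T₂, T₁;
     δ / k₂ * L₁, L₂, k₁m / k₂ * L₁ + L₂, L₁]

end TensorStructures

end

/-! `Log_ψ` is the only series with constant coefficient 1 satisfying `Log_ψ ψ_t = ∂ψ_t Log_ψ`. If
`g` is such a series, `g Exp_ψ` commutes with `D = ∂ψ_t`; since `D - θ` is nilpotent and `θ^(m) ≠ θ`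
for `m ≥ 1`, the map `B ↦ B D^(m) - D B` is injective, so `g Exp_ψ = 1`. For `ψ_t = B₀ + B₁ τ + B₂
τ²` it remains to exhibit a solution of `C_m B₀^(m) + C_{m-1} B₁^(m-1) + C_{m-2} B₂^(m-2) = B₀ C_m`
with `C_0 = 1` and `C_m = 0` for `m < 0` (`log_ofQuadratic_coeff`).

For `φ` this is the recurrence of the `𝓑_m` at `t = θ`, so `β_m = 𝓑_m(θ)` (`beta_natCast`).
Differentiating that recurrence gives one for `β'_m` with an extra term `β_m`. Twisting it shows
that `m ↦ β̃_{m-1}` is a second solution of the recurrence of `β_m`. The entries of `𝐋_m` are built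
from products of these sequences, and the matrix recurrence for `φ^{⊗2}` follows from the scalar
ones (`logMatrix_recurrence`), once a constant matrix `P` has removed `κ₁` from the constant term.

The map `(z₁, z₂, z₃) ↦ (z₁, z₂, z₂, z₃)` intertwines `Sym² φ` with `φ^{⊗2}`, so the same matrices
serve both (`log_coeff_of_intertwining`). Finally `L̃_0` is a Casoratian of the two solutions. It
satisfies a first-order recurrence free of `κ₁`, which is the one for the logarithm of `Alt² φ`. -/

/-! ### Linear recurrences characterizing the coefficients of the logarithm. -/

namespace TwistedPowerSeries

variable {F R : Type*} [Field F] [Ring R] [Algebra F R] {σ : R →ₐ[F] R}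

theorem coeff_mul_quadratic_one (g : TwistedPowerSeries σ) (B₀ B₁ B₂ : R) :
    (g * (quadratic (σ := σ) B₀ B₁ B₂).1).coeff 1 =
      g.coeff 1 * (σ ^ 1) B₀ + g.coeff 0 * B₁ := by
  rw [coeff_mul, Finset.Nat.sum_antidiagonal_succ']
  simp [quadratic]

theorem coeff_mul_quadratic (g : TwistedPowerSeries σ) (B₀ B₁ B₂ : R) (m : ℕ) :
    (g * (quadratic (σ := σ) B₀ B₁ B₂).1).coeff (m + 2) =
      g.coeff (m + 2) * (σ ^ (m + 2)) B₀ + g.coeff (m + 1) * (σ ^ (m + 1)) B₁ +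
        g.coeff m * (σ ^ m) B₂ := by
  have h : ∀ k, (quadratic (σ := σ) B₀ B₁ B₂).1.coeff (k + 3) = 0 := fun _ => rfl
  rw [coeff_mul, Finset.Nat.sum_antidiagonal_succ', Finset.Nat.sum_antidiagonal_succ']
  cases m with
  | zero => simp [quadratic]; abel
  | succ m =>
    rw [Finset.Nat.sum_antidiagonal_succ', Finset.sum_eq_zero]
    · simp [quadratic]; abel
    · intro p _
      rw [h, map_zero, mul_zero]

end TwistedPowerSeries

namespace TModule

variable {F : Type*} [Field F] [Fintype F] {n : Type*} [Fintype n] [DecidableEq n]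

/-- A twisted power series with constant coefficient `1` commuting with `∂ψ_t` is `1`. -/
theorem eq_one_of_commute_lie (E : TModule F n) (h : TwistedPowerSeries (matrixFrobenius F n))
    (h0 : h.coeff 0 = 1) (hc : h * E.lie Polynomial.X = E.lie Polynomial.X * h) : h = 1 := by
  ext1
  funext m
  cases m with
  | zero => rw [h0, TwistedPowerSeries.coeff_one', if_pos rfl]
  | succ m =>
    rw [TwistedPowerSeries.coeff_one', if_neg (Nat.succ_ne_zero m)]
    -- In degree `m + 1`, commuting with `∂ψ_t = D` says that `B ↦ B D^(m+1) - D B` kills the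
    -- coefficient. This map is injective.
    refine (sylvester_bijective E.nilpotent m).1 ?_
    have := congrArg (fun f => TwistedPowerSeries.coeff f (m + 1)) hc
    simp only [lie, TwistedPowerSeries.coeff_mul_const, TwistedPowerSeries.coeff_const_mul] at this
    simp only [zero_mul, mul_zero, sub_zero]
    exact sub_eq_zero.mpr this

/-- The logarithm series is characterized by `Log_ψ ψ_t = ∂ψ_t Log_ψ`. -/
theorem log_eq_of_mul_act (E : TModule F n) (g : TwistedPowerSeries (matrixFrobenius F n))
    (h0 : g.coeff 0 = 1) (hg : g * E.act Polynomial.X = E.lie Polynomial.X * g) : E.log = g := by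
  have h1 : g * E.exp = 1 := by
    refine E.eq_one_of_commute_lie _ ?_ ?_
    · rw [← TwistedPowerSeries.partialHom_apply, map_mul, TwistedPowerSeries.partialHom_apply,
        TwistedPowerSeries.partialHom_apply, h0, E.isExp_exp.1, one_mul]
    · rw [mul_assoc, E.isExp_exp.2, ← mul_assoc, hg, mul_assoc]
  have h2 : E.exp * E.log = 1 := E.isUnit_exp.mul_val_inv
  calc E.log = g * E.exp * E.log := by rw [h1, one_mul]
    _ = g := by rw [mul_assoc, h2, mul_one]

theorem log_coeff_zero (E : TModule F n) : E.log.coeff 0 = 1 := by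
  have h : TwistedPowerSeries.partialHom (E.exp * E.log) = 1 := by
    rw [show E.exp * E.log = 1 from E.isUnit_exp.mul_val_inv, map_one]
  rwa [map_mul, TwistedPowerSeries.partialHom_apply, TwistedPowerSeries.partialHom_apply,
    E.isExp_exp.1, one_mul] at h

/-- The coefficients of the logarithm of `ψ_t = B₀ + B₁ τ + B₂ τ²` are determined by a linear
recurrence. -/
theorem log_ofQuadratic_coeff (B₀ B₁ B₂ : Matrix n n (RatFunc F))
    (h : IsNilpotent (B₀ - Matrix.scalar n (theta F))) (C : ℕ → Matrix n n (RatFunc F))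
    (h0 : C 0 = 1)
    (h1 : C 1 * B₀.map (fun x => x ^ Fintype.card F) + B₁ = B₀ * C 1)
    (h2 : ∀ m, C (m + 2) * B₀.map (fun x => x ^ Fintype.card F ^ (m + 2)) +
      C (m + 1) * B₁.map (fun x => x ^ Fintype.card F ^ (m + 1)) +
        C m * B₂.map (fun x => x ^ Fintype.card F ^ m) = B₀ * C (m + 2)) (m : ℕ) :
    (ofQuadratic B₀ B₁ B₂ h).log.coeff m = C m := by
  have ha : (ofQuadratic B₀ B₁ B₂ h).act Polynomial.X =
      (TwistedPowerSeries.quadratic (σ := matrixFrobenius F n) B₀ B₁ B₂).1 := by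
    simp [act, ofQuadratic]
  rw [log_eq_of_mul_act (ofQuadratic B₀ B₁ B₂ h) ⟨C⟩ h0]
  ext1
  funext k
  rw [lie, ha, TwistedPowerSeries.coeff_const_mul]
  match k with
  | 0 => simp [TwistedPowerSeries.coeff_mul, h0]
  | 1 =>
    rw [TwistedPowerSeries.coeff_mul_quadratic_one, matrixFrobenius_pow_apply]
    simp only [h0, one_mul, pow_one]
    exact h1
  | k + 2 =>
    rw [TwistedPowerSeries.coeff_mul_quadratic]
    simp only [matrixFrobenius_pow_apply]
    exact h2 k

/-- The case of dimension one of `log_ofQuadratic_coeff`. -/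
theorem log_ofQuadratic_coeff_fin_one (b₀ b₁ b₂ : RatFunc F)
    (h : IsNilpotent (!![b₀] - Matrix.scalar (Fin 1) (theta F))) (c : ℕ → RatFunc F)
    (h0 : c 0 = 1) (h1 : c 1 * b₀ ^ Fintype.card F + b₁ = b₀ * c 1)
    (h2 : ∀ m, c (m + 2) * b₀ ^ Fintype.card F ^ (m + 2) +
      c (m + 1) * b₁ ^ Fintype.card F ^ (m + 1) + c m * b₂ ^ Fintype.card F ^ m =
        b₀ * c (m + 2)) (m : ℕ) :
    (ofQuadratic !![b₀] !![b₁] !![b₂] h).log.coeff m = !![c m] := by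
  refine log_ofQuadratic_coeff _ _ _ h (fun m => !![c m]) ?_ ?_ (fun m => ?_) m <;>
    ext i j <;> fin_cases i <;> fin_cases j <;>
    simp only [Matrix.add_apply, Matrix.mul_apply, Matrix.map_apply, Fin.sum_univ_one]
  · exact h0
  · exact h1
  · exact h2 m

end TModule
-- Coefficientwise sums of power series.
-- A `finsum` with infinite support is 0 by convention, so the finiteness hypothesis is needed.
-- Under it, both sides are finite sums over initial segments of `ℕ`.
theorem formalSum_eq_zero_add {s R : Type*} [CommSemiring R] (f : ℕ → MvPowerSeries s R)
    (hf : ∀ d, (Function.support fun m => MvPowerSeries.coeff d (f m)).Finite) :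
    formalSum f = f 0 + formalSum fun m => f (m + 1) := by
  ext d
  rw [map_add]
  change ∑ᶠ m, MvPowerSeries.coeff d (f m) = _ + ∑ᶠ m, MvPowerSeries.coeff d (f (m + 1))
  have hf' : (Function.support fun m => MvPowerSeries.coeff d (f (m + 1))).Finite :=
    (hf d).preimage (f := fun m => m + 1) (add_left_injective 1).injOn
  obtain ⟨N, hN⟩ := (hf d).bddAbove
  have hz : ∀ m, N < m → MvPowerSeries.coeff d (f m) = 0 := fun m hm => by
    by_contra hne
    exact absurd (hN (Function.mem_support.mpr hne)) (by omega)
  rw [finsum_eq_sum_of_support_subset (s := Finset.range (N + 2)),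
    finsum_eq_sum_of_support_subset (s := Finset.range (N + 1)), Finset.sum_range_succ', add_comm]
  · intro m hm
    by_contra h
    rw [Finset.mem_coe, Finset.mem_range] at h
    exact hm (hz _ (by omega))
  · intro m hm
    by_contra h
    rw [Finset.mem_coe, Finset.mem_range] at h
    exact hm (hz _ (by omega))

/-- Linear combinations of formal sums may be taken termwise. -/
theorem constMulVec_formalSum {l k s R : Type*} [Fintype k] [CommSemiring R] (B : Matrix l k R)
    (f : ℕ → k → MvPowerSeries s R)
    (hf : ∀ j d, (Function.support fun m => MvPowerSeries.coeff d (f m j)).Finite) (i : l) :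
    constMulVec B (fun j => formalSum fun m => f m j) i =
      formalSum fun m => constMulVec B (f m) i := by
  ext d
  simp only [constMulVec, map_sum, MvPowerSeries.coeff_C_mul]
  change ∑ j, B i j * ∑ᶠ m, MvPowerSeries.coeff d (f m j) =
    ∑ᶠ m, MvPowerSeries.coeff d (∑ j, MvPowerSeries.C (B i j) * f m j)
  simp only [map_sum, MvPowerSeries.coeff_C_mul]
  rw [finsum_sum_comm]
  · refine Finset.sum_congr rfl fun j _ => ?_
    exact mul_finsum' _ _ (hf j d)
  · intro j _
    exact (hf j d).subset fun m hm h => hm (by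
      dsimp only at h ⊢
      rw [h, mul_zero])

theorem constMulVec_mul {l k n s R : Type*} [Fintype k] [Fintype n] [CommSemiring R]
    (A : Matrix l k R) (B : Matrix k n R) (v : n → MvPowerSeries s R) :
    constMulVec (A * B) v = constMulVec A (constMulVec B v) := by
  funext i
  simp only [constMulVec, Matrix.mul_apply, map_sum, map_mul, Finset.sum_mul, Finset.mul_sum]
  rw [Finset.sum_comm]
  simp only [mul_assoc]

theorem constMulVec_one {n s R : Type*} [Fintype n] [DecidableEq n] [CommSemiring R]
    (v : n → MvPowerSeries s R) : constMulVec (1 : Matrix n n R) v = v := by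
  funext i
  simp [constMulVec, Matrix.one_apply, ite_mul, apply_ite]

/-- A monomial occurs in only finitely many of the vectors `B_m z^(q^m)`. -/
theorem finite_support_coeff_constMulVec_X_pow {l n R : Type*} [Fintype n] [CommSemiring R]
    {q : ℕ} (hq : 1 < q) (B : ℕ → Matrix l n R) (i : l) (d : n →₀ ℕ) :
    (Function.support fun m => MvPowerSeries.coeff d
      (constMulVec (B m) (fun j => (MvPowerSeries.X j : MvPowerSeries n R) ^ q ^ m) i)).Finite := by
  classical
  refine (Set.finite_iUnion (f := fun j : n => {m | d j = q ^ m}) fun j => ?_).subset ?_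
  -- The exponent of `X j` in `d` can equal `q ^ m` for at most one `m`.
  · exact Set.Subsingleton.finite fun a ha b hb =>
      Nat.pow_right_injective hq ((Set.mem_ofPred.mp ha).symm.trans (Set.mem_ofPred.mp hb))
  · intro m hm
    by_contra h
    simp only [Set.mem_iUnion, Set.mem_ofPred_eq, not_exists] at h
    refine hm ?_
    simp only [constMulVec, map_sum, MvPowerSeries.coeff_C_mul, MvPowerSeries.coeff_X_pow]
    refine Finset.sum_eq_zero fun j _ => ?_
    rw [if_neg, mul_zero]
    rintro rfl
    exact h j (by simp)

namespace TModule

variable {F : Type*} [Field F] [Fintype F] {n : Type*} [Fintype n] [DecidableEq n]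

/-- If the coefficients of `Log_ψ` in positive degrees are `P Q_m`, then
`Log_ψ(z) = z + P ∑_{m ≥ 1} Q_m z^(m)`. -/
theorem logFunction_eq (E : TModule F n) {k : Type*} [Fintype k] (P : Matrix n k (RatFunc F))
    (Q : ℕ → Matrix k n (RatFunc F)) (h0 : E.log.coeff 0 = 1)
    (h : ∀ m, E.log.coeff (m + 1) = P * Q (m + 1)) :
    E.logFunction = MvPowerSeries.X + constMulVec P (fun i => formalSum fun m =>
      constMulVec (Q (m + 1)) (fun j => MvPowerSeries.X j ^ Fintype.card F ^ (m + 1)) i) := by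
  have hq : 1 < Fintype.card F := Fintype.one_lt_card
  funext i
  rw [logFunction, formalSum_eq_zero_add _ fun d =>
    finite_support_coeff_constMulVec_X_pow hq (fun m => E.log.coeff m) i d, h0, constMulVec_one,
    Pi.add_apply, pow_zero, pow_one]
  congr 1
  rw [constMulVec_formalSum P (fun m => constMulVec (Q (m + 1))
      (fun j => MvPowerSeries.X j ^ Fintype.card F ^ (m + 1))) fun j d =>
    (finite_support_coeff_constMulVec_X_pow hq Q j d).preimage
      (f := fun m => m + 1) (add_left_injective 1).injOn]
  simp only [h, constMulVec_mul]

end TModule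
-- Values and first derivatives of rational functions at a regular point.
open Polynomial in
/-- `f ∈ K(t)` is regular at `t = c`, with value `v` and derivative `d` there. -/
def HasJet {K : Type*} [Field K] (c : K) (f : RatFunc K) (v d : K) : Prop :=
  ∃ p q : K[X], q.eval c ≠ 0 ∧ f * algebraMap K[X] (RatFunc K) q = algebraMap K[X] (RatFunc K) p ∧
    p.eval c = v * q.eval c ∧ p.derivative.eval c = d * q.eval c + v * q.derivative.eval c

namespace HasJet

open Polynomial

variable {K : Type*} [Field K] {c : K}

theorem zero : HasJet c (0 : RatFunc K) 0 0 := ⟨0, 1, by simp⟩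

theorem one : HasJet c (1 : RatFunc K) 1 0 := ⟨1, 1, by simp⟩

/-- Solving `h (t - e) = a f + b g` for `h`, on the level of values and derivatives. -/
theorem of_mul_X_sub_C {f g h : RatFunc K} {v d v' d' w w' a b e : K} (hf : HasJet c f v d)
    (hg : HasJet c g v' d') (he : c - e ≠ 0)
    (hh : h * (RatFunc.X - RatFunc.C e) = RatFunc.C a * f + RatFunc.C b * g)
    (hw : w * (c - e) = a * v + b * v') (hw' : w' * (c - e) + w = a * d + b * d') :
    HasJet c h w w' := by
  obtain ⟨p, q, h1, h2, h3, h4⟩ := hf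
  obtain ⟨p', q', h1', h2', h3', h4'⟩ := hg
  refine ⟨Polynomial.C a * p * q' + Polynomial.C b * p' * q, (Polynomial.X - Polynomial.C e) * (q * q'),
    ?_, ?_, ?_, ?_⟩
  · simpa using ⟨he, h1, h1'⟩
  · simp only [map_mul, map_add, map_sub, RatFunc.algebraMap_X, RatFunc.algebraMap_C, ← h2, ← h2']
    linear_combination (algebraMap K[X] (RatFunc K) q * algebraMap K[X] (RatFunc K) q') * hh
  · simp only [eval_mul, eval_add, eval_sub, eval_C, eval_X, h3, h3']
    linear_combination (-eval c q * eval c q') * hw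
  · simp only [derivative_mul, derivative_add, derivative_sub, derivative_C, derivative_X,
      eval_mul, eval_add, eval_sub, eval_C, eval_X, h3, h3', h4, h4', eval_zero, eval_one]
    linear_combination (-eval c q * eval c q') * hw' -
      (q'.derivative.eval c * eval c q + q.derivative.eval c * eval c q') * hw

/-- Passes from an arbitrary fraction `p / q` to the reduced one, in terms of which `RatFunc.eval`
and `derivT` are defined. The cross-multiplied identity `key` and its derivative, evaluated at `c`,
transfer all the data. -/
theorem num_denom {f : RatFunc K} {v d : K} (hf : HasJet c f v d) :
    f.denom.eval c ≠ 0 ∧ f.num.eval c = v * f.denom.eval c ∧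
      f.num.derivative.eval c = d * f.denom.eval c + v * f.denom.derivative.eval c := by
  obtain ⟨p, q, h1, h2, h3, h4⟩ := hf
  have hq : q ≠ 0 := by rintro rfl; simp at h1
  have hden : algebraMap K[X] (RatFunc K) f.denom ≠ 0 :=
    RatFunc.algebraMap_ne_zero f.denom_ne_zero
  have key : f.num * q = p * f.denom := by
    apply RatFunc.algebraMap_injective K
    have h5 := RatFunc.num_div_denom f
    rw [div_eq_iff hden] at h5
    rw [map_mul, map_mul, ← h2, h5]
    ring
  -- A zero of the reduced denominator at `c` would, as `q(c) ≠ 0`, also be a zero of the numerator,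
  -- against coprimality.
  have hd : f.denom.eval c ≠ 0 := by
    intro h
    have h6 : f.num.eval c = 0 := by
      have := congrArg (Polynomial.eval c) key
      rw [eval_mul, eval_mul, h, mul_zero] at this
      exact (mul_eq_zero.mp this).resolve_right h1
    obtain ⟨a, b, hab⟩ := f.isCoprime_num_denom
    have := congrArg (Polynomial.eval c) hab
    simp [h, h6] at this
  have hv : f.num.eval c = v * f.denom.eval c := by
    have := congrArg (Polynomial.eval c) key
    rw [eval_mul, eval_mul, h3] at this
    exact mul_right_cancel₀ h1 (by rw [this]; ring)
  refine ⟨hd, hv, mul_right_cancel₀ h1 ?_⟩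
  have := congrArg (fun r => Polynomial.eval c (Polynomial.derivative r)) key
  simp only [derivative_mul, eval_add, eval_mul, h3, h4, hv] at this
  linear_combination this

theorem eval_eq {f : RatFunc K} {v d : K} (hf : HasJet c f v d) :
    RatFunc.eval (RingHom.id K) c f = v := by
  obtain ⟨h1, h2, -⟩ := hf.num_denom
  rw [RatFunc.eval, ← Polynomial.eval, ← Polynomial.eval, h2, mul_div_cancel_right₀ _ h1]

end HasJet

/-! ### Recurrences for the values and derivatives of `𝓑_m` and its twist at `t = θ`. -/

section Jets

variable {F : Type*} [Field F]

theorem evalTheta_derivT {f : RatFunc (RatFunc F)} {v d : RatFunc F}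
    (hf : HasJet (theta F) f v d) : evalTheta (derivT f) = d := by
  obtain ⟨h1, h2, h3⟩ := hf.num_denom
  -- Only the value of `derivT f` matters here. The derivative supplied is simply the number solving
  -- the last condition of `HasJet`.
  refine HasJet.eval_eq (d :=
    ((Polynomial.derivative f.num * f.denom - f.num * Polynomial.derivative f.denom).derivative.eval
      (theta F) - d * (f.denom ^ 2).derivative.eval (theta F)) / (f.denom ^ 2).eval (theta F))
    ⟨_, f.denom ^ 2, ?_, div_mul_cancel₀ _ ?_, ?_, ?_⟩
  · simpa using h1
  · exact RatFunc.algebraMap_ne_zero (pow_ne_zero 2 f.denom_ne_zero)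
  · simp only [Polynomial.eval_sub, Polynomial.eval_mul, Polynomial.eval_pow, h2, h3]
    ring
  · rw [div_mul_cancel₀ _ (by simpa using h1)]
    ring

theorem X_sub_C_ne_zero {K : Type*} [Field K] (c : K) :
    (RatFunc.X - RatFunc.C c : RatFunc K) ≠ 0 := by
  rw [← RatFunc.algebraMap_X, ← RatFunc.algebraMap_C, ← map_sub]
  exact RatFunc.algebraMap_ne_zero (Polynomial.X_sub_C_ne_zero c)

/-- A sequence in `K(t)` satisfying the recurrence of the `𝓑_m` or of their twists consists of
functions regular at `t = θ`, and values and derivatives satisfy the corresponding recurrences. -/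
theorem exists_hasJet_of_recurrence (G : ℤ → RatFunc (RatFunc F)) (a e : ℕ → RatFunc F)
    (b : RatFunc F) (he : ∀ m, theta F - e m ≠ 0) (hneg : G (-1) = 0) (h0 : G 0 = 1)
    (hG : ∀ m : ℕ, G ((m : ℤ) + 1) * (RatFunc.X - RatFunc.C (e m)) =
      RatFunc.C (a m) * G m + RatFunc.C b * G ((m : ℤ) - 1)) (m : ℕ) :
    ∃ v d v' d', HasJet (theta F) (G m) v d ∧
      HasJet (theta F) (G ((m : ℤ) - 1)) v' d' := by
  induction m with
  | zero =>
    -- The induction carries two consecutive terms, as the recurrence is of second order. It starts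
    -- from `G 0 = 1` and `G (-1) = 0`.
    refine ⟨1, 0, 0, 0, ?_, ?_⟩
    · rw [Nat.cast_zero, h0]
      exact .one
    · rw [Nat.cast_zero, zero_sub, hneg]
      exact .zero
  | succ m ih =>
    obtain ⟨v, d, v', d', h1, h2⟩ := ih
    refine ⟨(a m * v + b * v') / (theta F - e m),
      (a m * d + b * d' - (a m * v + b * v') / (theta F - e m)) / (theta F - e m), v, d, ?_, ?_⟩
    · rw [Nat.cast_succ]
      refine h1.of_mul_X_sub_C h2 (he m) (hG m) (div_mul_cancel₀ _ (he m)) ?_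
      rw [div_mul_cancel₀ _ (he m)]
      ring
    · rwa [Nat.cast_succ, add_sub_cancel_right]

/-- The two identities are the recurrence at `t = θ` and its `t`-derivative there. The summand
without a factor `θ - e m` comes from differentiating `t - e m`. -/
theorem evalTheta_recurrence (G : ℤ → RatFunc (RatFunc F)) (a e : ℕ → RatFunc F)
    (b : RatFunc F) (he : ∀ m, theta F - e m ≠ 0) (hneg : G (-1) = 0) (h0 : G 0 = 1)
    (hG : ∀ m : ℕ, G ((m : ℤ) + 1) * (RatFunc.X - RatFunc.C (e m)) =
      RatFunc.C (a m) * G m + RatFunc.C b * G ((m : ℤ) - 1)) (m : ℕ) :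
    evalTheta (G ((m : ℤ) + 1)) * (theta F - e m) =
        a m * evalTheta (G m) + b * evalTheta (G ((m : ℤ) - 1)) ∧
      evalTheta (derivT (G ((m : ℤ) + 1))) * (theta F - e m) + evalTheta (G ((m : ℤ) + 1)) =
        a m * evalTheta (derivT (G m)) + b * evalTheta (derivT (G ((m : ℤ) - 1))) := by
  obtain ⟨v, d, v', d', h1, h2⟩ := exists_hasJet_of_recurrence G a e b he hneg h0 hG m
  have h3 := h1.of_mul_X_sub_C (w := (a m * v + b * v') / (theta F - e m))
    (w' := (a m * d + b * d' - (a m * v + b * v') / (theta F - e m)) / (theta F - e m))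
    h2 (he m) (hG m) (div_mul_cancel₀ _ (he m)) (by rw [div_mul_cancel₀ _ (he m)]; ring)
  rw [evalTheta_derivT h1, evalTheta_derivT h2, evalTheta_derivT h3]
  simp only [evalTheta]
  rw [h1.eval_eq, h2.eval_eq, h3.eval_eq, div_mul_cancel₀ _ (he m), div_mul_cancel₀ _ (he m)]
  exact ⟨rfl, by ring⟩

theorem evalTheta_zero : evalTheta (0 : RatFunc (RatFunc F)) = 0 := HasJet.zero.eval_eq

theorem evalTheta_one : evalTheta (1 : RatFunc (RatFunc F)) = 1 := HasJet.one.eval_eq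

variable [Fintype F]

theorem theta_sub_pow_ne (F : Type*) [Field F] [Fintype F] (m : ℕ) :
    theta F - theta F ^ Fintype.card F ^ (m + 1) ≠ 0 := by
  rw [← neg_ne_zero, neg_sub]
  exact TModule.theta_pow_ne F m

theorem ratB_succ_mul (κ₁ : F[X]) (κ₂ : Fˣ) (m : ℕ) :
    ratB κ₁ κ₂ ((m : ℤ) + 1) * (RatFunc.X - RatFunc.C (theta F ^ Fintype.card F ^ (m + 1))) =
      RatFunc.C (kappaOne κ₁ ^ Fintype.card F ^ m) * ratB κ₁ κ₂ m +
        RatFunc.C (kappaTwo κ₂) * ratB κ₁ κ₂ ((m : ℤ) - 1) := by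
  have := X_sub_C_ne_zero (theta F ^ Fintype.card F ^ (m + 1))
  rw [ratB_succ]
  field_simp

theorem twist_X : twist (F := F) RatFunc.X = RatFunc.X := by
  rw [← RatFunc.algebraMap_X, twist, RatFunc.coe_mapRingHom_eq_coe_map, ← div_one (algebraMap _ _ _),
    ← map_one (algebraMap (RatFunc F)[X] (RatFunc (RatFunc F))), RatFunc.map_apply_div]
  simp

theorem twist_C (a : RatFunc F) : twist (RatFunc.C a) = RatFunc.C (a ^ Fintype.card F) := by
  rw [← RatFunc.algebraMap_C, twist, RatFunc.coe_mapRingHom_eq_coe_map,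
    ← div_one (algebraMap _ _ _),
    ← map_one (algebraMap (RatFunc F)[X] (RatFunc (RatFunc F))), RatFunc.map_apply_div]
  simp

theorem kappaTwo_pow (κ₂ : Fˣ) (m : ℕ) : kappaTwo κ₂ ^ Fintype.card F ^ m = kappaTwo κ₂ := by
  rw [kappaTwo, ← map_pow, FiniteField.pow_card_pow]

/-- The twist fixes `t` and `κ₂ ∈ F_q` and raises `θ` and `κ₁` to the `q`-th power, so it advances
the Frobenius exponents in the recurrence by one. -/
theorem twist_ratB_succ_mul (κ₁ : F[X]) (κ₂ : Fˣ) (m : ℕ) :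
    twist (ratB κ₁ κ₂ ((m : ℤ) + 1)) *
        (RatFunc.X - RatFunc.C (theta F ^ Fintype.card F ^ (m + 2))) =
      RatFunc.C (kappaOne κ₁ ^ Fintype.card F ^ (m + 1)) * twist (ratB κ₁ κ₂ m) +
        RatFunc.C (kappaTwo κ₂) * twist (ratB κ₁ κ₂ ((m : ℤ) - 1)) := by
  have h := congrArg twist (ratB_succ_mul κ₁ κ₂ m)
  have hκ := kappaTwo_pow κ₂ 1
  rw [pow_one] at hκ
  simpa only [map_mul, map_add, map_sub, twist_X, twist_C, ← pow_mul, ← pow_succ, hκ] using h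

theorem evalTheta_ratB_succ (κ₁ : F[X]) (κ₂ : Fˣ) (m : ℕ) :
    evalTheta (ratB κ₁ κ₂ ((m : ℤ) + 1)) * (theta F - theta F ^ Fintype.card F ^ (m + 1)) =
        kappaOne κ₁ ^ Fintype.card F ^ m * evalTheta (ratB κ₁ κ₂ m) +
          kappaTwo κ₂ * evalTheta (ratB κ₁ κ₂ ((m : ℤ) - 1)) ∧
      betaPrime κ₁ κ₂ ((m : ℤ) + 1) * (theta F - theta F ^ Fintype.card F ^ (m + 1)) +
          evalTheta (ratB κ₁ κ₂ ((m : ℤ) + 1)) =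
        kappaOne κ₁ ^ Fintype.card F ^ m * betaPrime κ₁ κ₂ m +
          kappaTwo κ₂ * betaPrime κ₁ κ₂ ((m : ℤ) - 1) :=
  evalTheta_recurrence (ratB κ₁ κ₂) (fun m => kappaOne κ₁ ^ Fintype.card F ^ m)
    (fun m => theta F ^ Fintype.card F ^ (m + 1)) (kappaTwo κ₂) (theta_sub_pow_ne F)
    (ratB_neg κ₁ κ₂ (by norm_num)) (ratB_zero κ₁ κ₂) (ratB_succ_mul κ₁ κ₂) m

theorem betaPrime_neg (κ₁ : F[X]) (κ₂ : Fˣ) {m : ℤ} (hm : m < 0) : betaPrime κ₁ κ₂ m = 0 := by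
  rw [betaPrime, ratB_neg κ₁ κ₂ hm, evalTheta_derivT .zero]

theorem betaPrime_zero (κ₁ : F[X]) (κ₂ : Fˣ) : betaPrime κ₁ κ₂ 0 = 0 := by
  rw [betaPrime, ratB_zero, evalTheta_derivT .one]

theorem betaTilde_neg (κ₁ : F[X]) (κ₂ : Fˣ) {m : ℤ} (hm : m < 0) : betaTilde κ₁ κ₂ m = 0 := by
  rw [betaTilde, ratB_neg κ₁ κ₂ hm, map_zero, evalTheta_zero]

theorem betaTilde_zero (κ₁ : F[X]) (κ₂ : Fˣ) : betaTilde κ₁ κ₂ 0 = 1 := by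
  rw [betaTilde, ratB_zero, map_one, evalTheta_one]

/-- With `g_m = β̃_{m-1}` this reads `g_{m+2} (θ - θ^(m+2)) = κ₁^(m+1) g_{m+1} + κ₂ g_m`, the
recurrence of the `β_m`. -/
theorem betaTilde_succ (κ₁ : F[X]) (κ₂ : Fˣ) (m : ℕ) :
    betaTilde κ₁ κ₂ ((m : ℤ) + 1) * (theta F - theta F ^ Fintype.card F ^ (m + 2)) =
      kappaOne κ₁ ^ Fintype.card F ^ (m + 1) * betaTilde κ₁ κ₂ m +
        kappaTwo κ₂ * betaTilde κ₁ κ₂ ((m : ℤ) - 1) :=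
  (evalTheta_recurrence (fun m => twist (ratB κ₁ κ₂ m))
    (fun m => kappaOne κ₁ ^ Fintype.card F ^ (m + 1))
    (fun m => theta F ^ Fintype.card F ^ (m + 2)) (kappaTwo κ₂) (fun m => theta_sub_pow_ne F (m + 1))
    (by simp only [ratB_neg κ₁ κ₂ (show (-1 : ℤ) < 0 by norm_num), map_zero])
    (by simp only [ratB_zero, map_one]) (twist_ratB_succ_mul κ₁ κ₂) m).1

end Jets
-- The matrix recurrence for the tensor square, as an identity over an arbitrary field.
section LogMatrix

variable {K : Type*} [Field K]

/-- The shape of the matrices `𝐋_m`, where `c`, `δ`, `k₁` stand for `κ₂ / (θ - θ^(1))`,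
`θ - θ^(m)`, `κ₁^(m)`, and `b, b'`, `d, d'`, `g, g'` for the values at `m`, `m - 1` of the sequences
`β_m`, `β'_m`, `β̃_{m-1}`. -/
noncomputable def logMatrix (k₂ c δ k₁ b b' d d' g g' : K) : Matrix (Fin 4) (Fin 4) K :=
  !![b ^ 2 + δ * (2 * b * d), k₂ * (d * b' + b * d'), k₁ * (2 * b * d) + k₂ * (d * b' + b * d'),
      k₂ * (2 * b * d);
     δ / k₂ * (c * (b * g)), c * (b * g' - b' * g) + c * (b' * g),
      k₁ / k₂ * (c * (b * g)) + c * (b' * g), c * (b * g);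
     δ / k₂ * (c * (b * g)), c * (b' * g),
      c * (b * g' - b' * g) + k₁ / k₂ * (c * (b * g)) + c * (b' * g), c * (b * g);
     δ / k₂ * b ^ 2, b * b', k₁ / k₂ * b ^ 2 + b * b', b ^ 2]

/-- The coefficient of `τ^0` in `(φ^{⊗2})_t`. -/
noncomputable def tensorConst (θ k₁ k₂ : K) : Matrix (Fin 4) (Fin 4) K :=
  !![θ, 0, k₁, k₂; 0, θ, 0, 0; 0, 0, θ, 0; 0, 0, 0, θ]

/-- The coefficient of `τ` in `(φ^{⊗2})_t`. -/
noncomputable def tensorLin (k₁ k₂ : K) : Matrix (Fin 4) (Fin 4) K :=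
  !![0, 0, 0, 0; k₁, 0, k₂, 0; k₁, k₂, 0, 0; 0, 0, k₁, 0]

/-- The coefficient of `τ^2` in `(φ^{⊗2})_t`. -/
noncomputable def tensorQuad (k₂ : K) : Matrix (Fin 4) (Fin 4) K :=
  !![0, 0, 0, 0; 0, 0, 0, 0; 0, 0, 0, 0; k₂, 0, 0, 0]

/-- The first column amounts to products of two scalar recurrences: `hb` with `hd`, `hb` with `hg`
twice, and `hb` with itself. In the two middle columns each recurrence is multiplied by a preceding
term. The last column needs no recurrence. -/
theorem logMatrix_recurrence {k₂ c θ θ₂ κ κ₁ b₂ b₁ b₀ d₂ d₁ d₀ g₂ g₁ g₀ : K} (hk : k₂ ≠ 0)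
    (hb : b₂ * (θ - θ₂) = κ₁ * b₁ + k₂ * b₀)
    (hd : d₂ * (θ - θ₂) + b₂ = κ₁ * d₁ + k₂ * d₀)
    (hg : g₂ * (θ - θ₂) = κ₁ * g₁ + k₂ * g₀) (δ₁ δ₀ κ₀ b d g : K) :
    logMatrix k₂ c (θ - θ₂) κ b₂ b₁ d₂ d₁ g₂ g₁ * tensorConst θ₂ κ k₂ +
        logMatrix k₂ c δ₁ κ₁ b₁ b₀ d₁ d₀ g₁ g₀ * tensorLin κ₁ k₂ +
        logMatrix k₂ c δ₀ κ₀ b₀ b d₀ d g₀ g * tensorQuad k₂ =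
      tensorConst θ 0 k₂ * logMatrix k₂ c (θ - θ₂) κ b₂ b₁ d₂ d₁ g₂ g₁ := by
  -- Replacing `k₂⁻¹` by a variable `u` with `k₂ u = 1` turns the 16 entries into polynomial
  -- identities.
  obtain ⟨u, hu⟩ : ∃ u, u = k₂⁻¹ := ⟨_, rfl⟩
  have hku : k₂ * u = 1 := by rw [hu, mul_inv_cancel₀ hk]
  simp only [logMatrix, tensorConst, tensorLin, tensorQuad, div_eq_mul_inv, ← hu]
  clear hu hk
  ext i j
  fin_cases i <;> fin_cases j <;>
    simp only [Matrix.mul_apply, Matrix.add_apply, Fin.sum_univ_four, Fin.zero_eta,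
      Fin.mk_one, Fin.reduceFinMk, Matrix.of_apply, Matrix.cons_val, Matrix.cons_val_zero,
      Matrix.cons_val_one]
  · linear_combination (-2 * (b₂ + d₂ * (θ - θ₂))) * hb - 2 * (κ₁ * b₁ + k₂ * b₀) * hd - (θ - θ₂) * b₂ ^ 2 * hku
  · linear_combination (-k₂ * b₁) * hd - k₂ * d₁ * hb
  · linear_combination (-k₂ * b₁) * hd - k₂ * d₁ * hb - κ * b₂ ^ 2 * hku
  · ring
  · linear_combination (-u * c * (g₂ * (θ - θ₂))) * hb - u * c * (κ₁ * b₁ + k₂ * b₀) * hg -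
      c * (κ₁ * (b₁ * g₀ + b₀ * g₁) + k₂ * b₀ * g₀) * hku
  · linear_combination (-c * g₁) * hb + c * κ₁ * b₁ * g₁ * hku
  · linear_combination (-c * b₁) * hg
  · linear_combination c * (θ - θ₂) * b₂ * g₂ * hku
  · linear_combination (-u * c * (g₂ * (θ - θ₂))) * hb - u * c * (κ₁ * b₁ + k₂ * b₀) * hg -
      c * (κ₁ * (b₁ * g₀ + b₀ * g₁) + k₂ * b₀ * g₀) * hku
  · linear_combination (-c * b₁) * hg + c * κ₁ * b₁ * g₁ * hku
  · linear_combination (-c * g₁) * hb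
  · linear_combination c * (θ - θ₂) * b₂ * g₂ * hku
  · linear_combination (-u * (b₂ * (θ - θ₂) + (κ₁ * b₁ + k₂ * b₀))) * hb - (2 * κ₁ * b₁ * b₀ + k₂ * b₀ ^ 2) * hku
  · linear_combination -b₁ * hb + κ₁ * b₁ ^ 2 * hku
  · linear_combination -b₁ * hb
  · linear_combination (θ - θ₂) * b₂ ^ 2 * hku

end LogMatrix
-- Coefficients of the logarithms of `φ`, `φ^{⊗2}`, `Sym² φ` and `Alt² φ`.
section Logarithms

variable {F : Type*} [Field F]

theorem kappaTwo_ne_zero (κ₂ : Fˣ) : kappaTwo κ₂ ≠ 0 := by simp [kappaTwo]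

variable [Fintype F]

theorem cast_add_two_sub_one (m : ℕ) : ((m + 2 : ℕ) : ℤ) - 1 = ((m + 1 : ℕ) : ℤ) := by
  push_cast; ring

theorem cast_add_one_sub_one (m : ℕ) : ((m + 1 : ℕ) : ℤ) - 1 = m := by
  push_cast; ring

theorem cast_add_two_sub_two (m : ℕ) : ((m + 2 : ℕ) : ℤ) - 2 = m := by
  push_cast; ring

theorem cast_add_one_sub_two (m : ℕ) : ((m + 1 : ℕ) : ℤ) - 2 = (m : ℤ) - 1 := by
  push_cast; ring

/-- The values `𝓑_m(θ)` solve the recurrence that determines the coefficients of `Log_φ`. -/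
theorem beta_natCast (κ₁ : F[X]) (κ₂ : Fˣ) (m : ℕ) :
    beta κ₁ κ₂ m = evalTheta (ratB κ₁ κ₂ m) := by
  have hrec := fun m => (evalTheta_ratB_succ κ₁ κ₂ m).1
  have hlog : (drinfeldModule κ₁ κ₂).log.coeff m = !![evalTheta (ratB κ₁ κ₂ (m : ℤ))] := by
    refine TModule.log_ofQuadratic_coeff_fin_one _ _ _ _
      (fun m => evalTheta (ratB κ₁ κ₂ (m : ℤ))) ?_ ?_ (fun m => ?_) m
    · rw [Nat.cast_zero, ratB_zero, evalTheta_one]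
    · have h := hrec 0
      rw [Nat.cast_zero, zero_add, zero_sub, ratB_neg κ₁ κ₂ (show (-1 : ℤ) < 0 by norm_num),
        evalTheta_zero, ratB_zero, evalTheta_one, zero_add, pow_zero, pow_one, pow_one] at h
      rw [Nat.cast_one]
      linear_combination -h
    · have h := hrec (m + 1)
      rw [cast_add_one_sub_one, ← Nat.cast_succ] at h
      rw [kappaTwo_pow]
      linear_combination -h
  rw [beta, if_neg (by omega), Int.toNat_natCast, hlog]
  rfl

theorem beta_neg (κ₁ : F[X]) (κ₂ : Fˣ) {m : ℤ} (hm : m < 0) : beta κ₁ κ₂ m = 0 := if_pos hm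

theorem beta_natCast_sub_one (κ₁ : F[X]) (κ₂ : Fˣ) (m : ℕ) :
    beta κ₁ κ₂ ((m : ℤ) - 1) = evalTheta (ratB κ₁ κ₂ ((m : ℤ) - 1)) := by
  cases m with
  | zero => rw [beta_neg _ _ (by norm_num), ratB_neg _ _ (by norm_num), evalTheta_zero]
  | succ m => rw [cast_add_one_sub_one, beta_natCast]

theorem beta_zero (κ₁ : F[X]) (κ₂ : Fˣ) : beta κ₁ κ₂ 0 = 1 := by
  rw [← Nat.cast_zero, beta_natCast, Nat.cast_zero, ratB_zero, evalTheta_one]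

theorem beta_succ (κ₁ : F[X]) (κ₂ : Fˣ) (m : ℕ) :
    beta κ₁ κ₂ ((m + 1 : ℕ) : ℤ) * (theta F - theta F ^ Fintype.card F ^ (m + 1)) =
      kappaOne κ₁ ^ Fintype.card F ^ m * beta κ₁ κ₂ m +
        kappaTwo κ₂ * beta κ₁ κ₂ ((m : ℤ) - 1) := by
  rw [beta_natCast, beta_natCast, beta_natCast_sub_one]
  exact (evalTheta_ratB_succ κ₁ κ₂ m).1

theorem betaPrime_succ (κ₁ : F[X]) (κ₂ : Fˣ) (m : ℕ) :
    betaPrime κ₁ κ₂ ((m + 1 : ℕ) : ℤ) * (theta F - theta F ^ Fintype.card F ^ (m + 1)) +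
        beta κ₁ κ₂ ((m + 1 : ℕ) : ℤ) =
      kappaOne κ₁ ^ Fintype.card F ^ m * betaPrime κ₁ κ₂ m +
        kappaTwo κ₂ * betaPrime κ₁ κ₂ ((m : ℤ) - 1) := by
  rw [beta_natCast]
  exact (evalTheta_ratB_succ κ₁ κ₂ m).2

theorem matrixL_eq_logMatrix (κ₁ : F[X]) (κ₂ : Fˣ) (m : ℕ) :
    matrixL κ₁ κ₂ m = logMatrix (kappaTwo κ₂)
      (kappaTwo κ₂ / (theta F - theta F ^ Fintype.card F))
      (theta F - theta F ^ Fintype.card F ^ m) (kappaOne κ₁ ^ Fintype.card F ^ m)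
      (beta κ₁ κ₂ m) (beta κ₁ κ₂ ((m : ℤ) - 1)) (betaPrime κ₁ κ₂ m) (betaPrime κ₁ κ₂ ((m : ℤ) - 1))
      (betaTilde κ₁ κ₂ ((m : ℤ) - 1)) (betaTilde κ₁ κ₂ ((m : ℤ) - 2)) := by
  simp only [matrixL, logMatrix, coeffL1, coeffL2, coeffL1Prime, coeffL2Prime, coeffL0Tilde,
    coeffL1Tilde, coeffL2Tilde, mul_sub]

/-- The value at `m = 0` of the matrices `𝐋_m` when `β̃_{-2}` is replaced by the value
`(θ - θ^(1)) / κ₂` extrapolated from the recurrence of the sequence `β̃_m`. -/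
noncomputable def initialMatrix (κ₁ : F[X]) (κ₂ : Fˣ) : Matrix (Fin 4) (Fin 4) (RatFunc F) :=
  !![1, 0, 0, 0; 0, 1, 0, 0; 0, 0, 1, 0; 0, 0, kappaOne κ₁ / kappaTwo κ₂, 1]

/-- The last argument is forced by `g_1 (θ - θ^(1)) = κ₁ g_0 + κ₂ g_{-1}` with `g_1 = β̃_0 = 1` and
`g_0 = β̃_{-1} = 0`. The convention `β̃_{-2} = 0` would break the recurrence at `m = 1`. -/
theorem initialMatrix_eq_logMatrix (κ₁ : F[X]) (κ₂ : Fˣ) :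
    initialMatrix κ₁ κ₂ = logMatrix (kappaTwo κ₂)
      (kappaTwo κ₂ / (theta F - theta F ^ Fintype.card F)) 0 (kappaOne κ₁)
      1 0 0 0 0 ((theta F - theta F ^ Fintype.card F) / kappaTwo κ₂) := by
  have h := theta_sub_pow_ne F 0
  rw [zero_add, pow_one] at h
  have h1 : kappaTwo κ₂ / (theta F - theta F ^ Fintype.card F) *
      ((theta F - theta F ^ Fintype.card F) / kappaTwo κ₂) = 1 := by
    rw [div_mul_div_cancel₀ h, div_self (kappaTwo_ne_zero κ₂)]
  ext i j
  fin_cases i <;> fin_cases j <;> simp [initialMatrix, logMatrix, h1]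

theorem matrixL_one_recurrence (κ₁ : F[X]) (κ₂ : Fˣ) :
    matrixL κ₁ κ₂ 1 * tensorConst (theta F ^ Fintype.card F ^ 1) (kappaOne κ₁ ^ Fintype.card F ^ 1)
        (kappaTwo κ₂) + initialMatrix κ₁ κ₂ * tensorLin (kappaOne κ₁) (kappaTwo κ₂) =
      tensorConst (theta F) 0 (kappaTwo κ₂) * matrixL κ₁ κ₂ 1 := by
  have hb := beta_succ κ₁ κ₂ 0
  have hd := betaPrime_succ κ₁ κ₂ 0
  simp only [zero_add, pow_zero, pow_one, Nat.cast_zero, zero_sub, Nat.cast_one, beta_zero,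
    betaPrime_zero, beta_neg κ₁ κ₂ (show (-1 : ℤ) < 0 by norm_num),
    betaPrime_neg κ₁ κ₂ (show (-1 : ℤ) < 0 by norm_num)] at hb hd
  rw [matrixL_eq_logMatrix, initialMatrix_eq_logMatrix]
  simp only [pow_one, Nat.cast_one, sub_self, beta_zero, betaPrime_zero, betaTilde_zero]
  rw [show (1 : ℤ) - 2 = -1 by norm_num, betaTilde_neg κ₁ κ₂ (show (-1 : ℤ) < 0 by norm_num)]
  have h := logMatrix_recurrence (c := kappaTwo κ₂ / (theta F - theta F ^ Fintype.card F))
    (κ := kappaOne κ₁ ^ Fintype.card F) (g₂ := 1) (g₁ := 0)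
    (g₀ := (theta F - theta F ^ Fintype.card F) / kappaTwo κ₂) (kappaTwo_ne_zero κ₂) hb hd
    (by rw [mul_div_cancel₀ _ (kappaTwo_ne_zero κ₂)]; ring) 0 0 0 0 0 0
  -- The general recurrence has one more term, in index `-1`. Its factor `tensorQuad` retains only
  -- the last column, all of whose entries are multiples of `β_{-1} = 0`.
  rw [← h, left_eq_add]
  ext i j
  fin_cases i <;> fin_cases j <;>
    simp [logMatrix, tensorQuad, Matrix.mul_apply, Fin.sum_univ_succ]

theorem matrixL_recurrence (κ₁ : F[X]) (κ₂ : Fˣ) (m : ℕ) :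
    matrixL κ₁ κ₂ (m + 2) * tensorConst (theta F ^ Fintype.card F ^ (m + 2))
        (kappaOne κ₁ ^ Fintype.card F ^ (m + 2)) (kappaTwo κ₂) +
        matrixL κ₁ κ₂ (m + 1) * tensorLin (kappaOne κ₁ ^ Fintype.card F ^ (m + 1)) (kappaTwo κ₂) +
        matrixL κ₁ κ₂ m * tensorQuad (kappaTwo κ₂) =
      tensorConst (theta F) 0 (kappaTwo κ₂) * matrixL κ₁ κ₂ (m + 2) := by
  have hb := beta_succ κ₁ κ₂ (m + 1)
  have hd := betaPrime_succ κ₁ κ₂ (m + 1)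
  have hg := betaTilde_succ κ₁ κ₂ m
  rw [cast_add_one_sub_one] at hb hd
  rw [← Nat.cast_succ] at hg
  simp only [matrixL_eq_logMatrix, cast_add_two_sub_one, cast_add_one_sub_one,
    cast_add_two_sub_two, cast_add_one_sub_two]
  exact logMatrix_recurrence (kappaTwo_ne_zero κ₂) hb hd hg _ _ _ _ _ _

/-- The two matrices differ, but `tensorQuad` sees only their last columns, where `β̃_{m-2}` does
not occur. Hence `matrixL_recurrence` also serves at `m = 0`. -/
theorem initialMatrix_mul_tensorQuad (κ₁ : F[X]) (κ₂ : Fˣ) :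
    initialMatrix κ₁ κ₂ * tensorQuad (kappaTwo κ₂) =
      matrixL κ₁ κ₂ 0 * tensorQuad (kappaTwo κ₂) := by
  rw [matrixL_eq_logMatrix, Nat.cast_zero, beta_zero, betaPrime_zero, zero_sub,
    betaTilde_neg κ₁ κ₂ (show (-1 : ℤ) < 0 by norm_num)]
  ext i j
  fin_cases i <;> fin_cases j <;>
    simp [initialMatrix, logMatrix, tensorQuad, Matrix.mul_apply, Fin.sum_univ_succ]

/-- `J` carries all three coefficients of `ψ_t`, with their twists, to those of `φ^{⊗2}`, while `P`
need only be compatible with the constant terms, after `κ₁` is replaced by 0. Multiplying the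
recurrence of the `𝐋_m` by `P` on the left and `J` on the right gives the one for `ψ`. -/
theorem log_coeff_of_intertwining {n : Type*} [Fintype n] [DecidableEq n] (κ₁ : F[X]) (κ₂ : Fˣ)
    {B₀ B₁ B₂ : Matrix n n (RatFunc F)} (h : IsNilpotent (B₀ - Matrix.scalar n (theta F)))
    (P : Matrix n (Fin 4) (RatFunc F)) (J : Matrix (Fin 4) n (RatFunc F))
    (hP : B₀ * P = P * tensorConst (theta F) 0 (kappaTwo κ₂))
    (hJ₀ : ∀ m, J * B₀.map (fun x => x ^ Fintype.card F ^ m) =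
      tensorConst (theta F ^ Fintype.card F ^ m) (kappaOne κ₁ ^ Fintype.card F ^ m)
        (kappaTwo κ₂) * J)
    (hJ₁ : ∀ m, J * B₁.map (fun x => x ^ Fintype.card F ^ m) =
      tensorLin (kappaOne κ₁ ^ Fintype.card F ^ m) (kappaTwo κ₂) * J)
    (hJ₂ : ∀ m, J * B₂.map (fun x => x ^ Fintype.card F ^ m) = tensorQuad (kappaTwo κ₂) * J)
    (hPJ : P * initialMatrix κ₁ κ₂ * J = 1) (m : ℕ) :
    (TModule.ofQuadratic B₀ B₁ B₂ h).log.coeff m =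
      P * ((if m = 0 then initialMatrix κ₁ κ₂ else matrixL κ₁ κ₂ m) * J) := by
  refine TModule.log_ofQuadratic_coeff B₀ B₁ B₂ h
    (fun m => P * ((if m = 0 then initialMatrix κ₁ κ₂ else matrixL κ₁ κ₂ m) * J)) ?_ ?_ ?_ m
  · rw [if_pos rfl, ← Matrix.mul_assoc, hPJ]
  · have h0 := hJ₀ 1
    have h1 := hJ₁ 0
    simp only [pow_zero, pow_one, Matrix.map_id'] at h0 h1
    have hr := matrixL_one_recurrence κ₁ κ₂
    simp only [pow_one] at hr
    rw [if_neg one_ne_zero]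
    calc P * (matrixL κ₁ κ₂ 1 * J) * B₀.map (fun x => x ^ Fintype.card F) + B₁
        = P * (matrixL κ₁ κ₂ 1 * (J * B₀.map (fun x => x ^ Fintype.card F))) +
          P * initialMatrix κ₁ κ₂ * J * B₁ := by
            rw [hPJ, Matrix.one_mul]; simp only [Matrix.mul_assoc]
      _ = P * (matrixL κ₁ κ₂ 1 * tensorConst (theta F ^ Fintype.card F)
            (kappaOne κ₁ ^ Fintype.card F) (kappaTwo κ₂) +
          initialMatrix κ₁ κ₂ * tensorLin (kappaOne κ₁) (kappaTwo κ₂)) * J := by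
            rw [h0, Matrix.mul_assoc _ J, h1]
            simp only [Matrix.mul_assoc, Matrix.mul_add, Matrix.add_mul]
      _ = B₀ * (P * (matrixL κ₁ κ₂ 1 * J)) := by
            rw [hr, ← Matrix.mul_assoc P, ← hP]
            simp only [Matrix.mul_assoc]
  · intro m
    have h2 : (if m = 0 then initialMatrix κ₁ κ₂ else matrixL κ₁ κ₂ m) *
        tensorQuad (kappaTwo κ₂) = matrixL κ₁ κ₂ m * tensorQuad (kappaTwo κ₂) := by
      split_ifs with hm
      · rw [hm, initialMatrix_mul_tensorQuad]
      · rfl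
    rw [if_neg (by omega), if_neg (by omega)]
    simp only [Matrix.mul_assoc, hJ₀, hJ₁, hJ₂]
    rw [← Matrix.mul_assoc (ite _ _ _), h2, ← Matrix.mul_assoc B₀, hP]
    simp only [← Matrix.mul_assoc]
    rw [← Matrix.add_mul, ← Matrix.add_mul]
    simp only [Matrix.mul_assoc P]
    rw [← Matrix.mul_add, ← Matrix.mul_add, matrixL_recurrence, Matrix.mul_assoc]

/-- In the Casoratian `b_m g_{m-1} - b_{m-1} g_m` of two solutions of one second-order recurrence,
the `κ₁` terms cancel and `κ₂` appears with a minus sign. -/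
theorem coeffL0Tilde_recurrence (κ₁ : F[X]) (κ₂ : Fˣ) (m : ℕ) :
    coeffL0Tilde κ₁ κ₂ ((m + 2 : ℕ) : ℤ) * (theta F - theta F ^ Fintype.card F ^ (m + 2)) =
      -kappaTwo κ₂ * coeffL0Tilde κ₁ κ₂ ((m + 1 : ℕ) : ℤ) := by
  have hb := beta_succ κ₁ κ₂ (m + 1)
  have hg := betaTilde_succ κ₁ κ₂ m
  rw [cast_add_one_sub_one] at hb
  rw [← Nat.cast_succ] at hg
  simp only [coeffL0Tilde, cast_add_two_sub_one, cast_add_one_sub_one,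
    cast_add_two_sub_two, cast_add_one_sub_two]
  linear_combination (kappaTwo κ₂ / (theta F - theta F ^ Fintype.card F)) *
    (betaTilde κ₁ κ₂ (m : ℤ) * hb - beta κ₁ κ₂ ((m + 1 : ℕ) : ℤ) * hg)

theorem coeffL0Tilde_one_mul (κ₁ : F[X]) (κ₂ : Fˣ) :
    coeffL0Tilde κ₁ κ₂ 1 * (theta F - theta F ^ Fintype.card F) = -kappaTwo κ₂ := by
  have h := theta_sub_pow_ne F 0
  rw [zero_add, pow_one] at h
  rw [coeffL0Tilde, sub_self, beta_zero, betaTilde_zero, show (1 : ℤ) - 2 = -1 by norm_num,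
    betaTilde_neg κ₁ κ₂ (show (-1 : ℤ) < 0 by norm_num)]
  field_simp
  ring

theorem alternatingSquare_log_coeff (κ₁ : F[X]) (κ₂ : Fˣ) (m : ℕ) :
    (alternatingSquare κ₂).log.coeff m =
      !![if m = 0 then 1 else coeffL0Tilde κ₁ κ₂ (m : ℤ)] := by
  refine TModule.log_ofQuadratic_coeff_fin_one _ _ _ _
    (fun m => if m = 0 then 1 else coeffL0Tilde κ₁ κ₂ (m : ℤ)) (if_pos rfl) ?_ (fun m => ?_) m
  · rw [if_neg one_ne_zero, Nat.cast_one]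
    linear_combination -coeffL0Tilde_one_mul κ₁ κ₂
  -- `-κ₂` lies in `F_q`, hence is fixed by Frobenius.
  · have hneg : (-kappaTwo κ₂) ^ Fintype.card F ^ (m + 1) = -kappaTwo κ₂ := by
      rw [kappaTwo, ← map_neg, ← map_pow, FiniteField.pow_card_pow]
    rw [if_neg (by omega), if_neg (by omega), hneg,
      zero_pow (pow_ne_zero m Fintype.card_ne_zero)]
    linear_combination -coeffL0Tilde_recurrence κ₁ κ₂ m

/-- Here `J = 1`, and `P` is the inverse of `initialMatrix`. -/
theorem tensorSquare_log_coeff (κ₁ : F[X]) (κ₂ : Fˣ) (m : ℕ) :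
    (tensorSquare κ₁ κ₂).log.coeff m =
      !![1, 0, 0, 0;
         0, 1, 0, 0;
         0, 0, 1, 0;
         0, 0, -(kappaOne κ₁ / kappaTwo κ₂), 1] *
        ((if m = 0 then initialMatrix κ₁ κ₂ else matrixL κ₁ κ₂ m) * 1) := by
  have hκ := kappaTwo_pow κ₂
  have hκ0 := kappaTwo_ne_zero κ₂
  have hq : Fintype.card F ≠ 0 := Fintype.card_ne_zero
  refine log_coeff_of_intertwining κ₁ κ₂ _ _ _ ?_ (fun m => ?_) (fun m => ?_) (fun m => ?_) ?_ m
  · ext i j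
    fin_cases i <;> fin_cases j <;>
      simp [tensorConst, Matrix.mul_apply, Fin.sum_univ_succ] <;> field_simp <;> ring
  · rw [one_mul, mul_one]
    ext i j
    fin_cases i <;> fin_cases j <;> simp [tensorConst, hκ, hq]
  · rw [one_mul, mul_one]
    ext i j
    fin_cases i <;> fin_cases j <;> simp [tensorLin, hκ, hq]
  · rw [one_mul, mul_one]
    ext i j
    fin_cases i <;> fin_cases j <;> simp [tensorQuad, hκ, hq]
  · rw [mul_one]
    ext i j
    fin_cases i <;> fin_cases j <;>
      simp [initialMatrix, Matrix.mul_apply, Fin.sum_univ_succ]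

/-- The matrix of `(z₁, z₂, z₃) ↦ (z₁, z₂, z₂, z₃)`. -/
noncomputable def symmetricInclusion (K : Type*) [Field K] : Matrix (Fin 4) (Fin 3) K :=
  !![1, 0, 0; 0, 1, 0; 0, 1, 0; 0, 0, 1]

/-- The second row of `P` averages the two middle coordinates. The `κ₁` entries of the last row
cancel the `κ₁` in the constant term and make `P * initialMatrix` a left inverse of the inclusion.
-/
theorem symmetricSquare_log_coeff (κ₁ : F[X]) (κ₂ : Fˣ) (hF : ringChar F ≠ 2) (m : ℕ) :
    (symmetricSquare κ₁ κ₂).log.coeff m =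
      !![1, 0, 0, 0;
         0, 1 / 2, 1 / 2, 0;
         0, -(kappaOne κ₁ / (2 * kappaTwo κ₂)), -(kappaOne κ₁ / (2 * kappaTwo κ₂)), 1] *
        ((if m = 0 then initialMatrix κ₁ κ₂ else matrixL κ₁ κ₂ m) *
          symmetricInclusion (RatFunc F)) := by
  have hκ := kappaTwo_pow κ₂
  have hκ0 := kappaTwo_ne_zero κ₂
  have hq : Fintype.card F ≠ 0 := Fintype.card_ne_zero
  have h2 : (2 : RatFunc F) ≠ 0 := by
    rw [← map_ofNat (algebraMap F (RatFunc F)) 2]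
    exact (map_ne_zero _).mpr (Ring.two_ne_zero hF)
  refine log_coeff_of_intertwining κ₁ κ₂ _ _ _ ?_ (fun m => ?_) (fun m => ?_) (fun m => ?_) ?_ m
  · ext i j
    fin_cases i <;> fin_cases j <;>
      simp [tensorConst, Matrix.mul_apply, Fin.sum_univ_succ] <;> field_simp <;> ring
  · ext i j
    fin_cases i <;> fin_cases j <;>
      simp [tensorConst, symmetricInclusion, hκ, hq, Matrix.mul_apply, Fin.sum_univ_succ]
  · ext i j
    fin_cases i <;> fin_cases j <;>
      simp [tensorLin, symmetricInclusion, hκ, hq, Matrix.mul_apply, Fin.sum_univ_succ]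
  · ext i j
    fin_cases i <;> fin_cases j <;>
      simp [tensorQuad, symmetricInclusion, hκ, hq, Matrix.mul_apply, Fin.sum_univ_succ]
  · ext i j
    fin_cases i <;> fin_cases j <;>
      simp [initialMatrix, symmetricInclusion, Matrix.mul_apply, Fin.sum_univ_succ] <;>
      field_simp <;> ring

end Logarithms
/-- Explicit logarithms of `φ^{⊗2}`, `Sym² φ` and `Alt² φ` for the Drinfeld module
`φ_t = θ + κ₁ τ + κ₂ τ²` with `κ₁ ∈ F_q[θ]` and `κ₂ ∈ F_q^×`, as identities of (vectors of) formal
power series in `z_1 = X 0, z_2 = X 1, …` over `K = F_q(θ)`. The index `m + 1` below runs over the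
positive integers. -/
theorem corollaryC {F : Type*} [Field F] [Fintype F] (κ₁ : Polynomial F) (κ₂ : Fˣ) :
    ((tensorSquare κ₁ κ₂).logFunction =
      MvPowerSeries.X + constMulVec
        !![1, 0, 0, 0;
           0, 1, 0, 0;
           0, 0, 1, 0;
           0, 0, -(kappaOne κ₁ / kappaTwo κ₂), 1]
        (fun i => formalSum fun m => constMulVec (matrixL κ₁ κ₂ (m + 1))
          ![MvPowerSeries.X 0 ^ Fintype.card F ^ (m + 1),
            MvPowerSeries.X 1 ^ Fintype.card F ^ (m + 1),
            MvPowerSeries.X 2 ^ Fintype.card F ^ (m + 1),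
            MvPowerSeries.X 3 ^ Fintype.card F ^ (m + 1)] i)) ∧
    (ringChar F ≠ 2 → (symmetricSquare κ₁ κ₂).logFunction =
      MvPowerSeries.X + constMulVec
        !![1, 0, 0, 0;
           0, 1 / 2, 1 / 2, 0;
           0, -(kappaOne κ₁ / (2 * kappaTwo κ₂)), -(kappaOne κ₁ / (2 * kappaTwo κ₂)), 1]
        (fun i => formalSum fun m => constMulVec (matrixL κ₁ κ₂ (m + 1))
          ![MvPowerSeries.X 0 ^ Fintype.card F ^ (m + 1),
            MvPowerSeries.X 1 ^ Fintype.card F ^ (m + 1),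
            MvPowerSeries.X 1 ^ Fintype.card F ^ (m + 1),
            MvPowerSeries.X 2 ^ Fintype.card F ^ (m + 1)] i)) ∧
    (alternatingSquare κ₂).logFunction 0 =
      MvPowerSeries.X 0 + formalSum fun m =>
        MvPowerSeries.C (coeffL0Tilde κ₁ κ₂ ((m + 1 : ℕ) : ℤ)) *
          MvPowerSeries.X 0 ^ Fintype.card F ^ (m + 1) := by
  refine ⟨?_, fun hF => ?_, ?_⟩
  · have h := fun m => tensorSquare_log_coeff κ₁ κ₂ (m + 1)
    simp only [Nat.succ_ne_zero, if_false, Matrix.mul_one] at h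
    rw [TModule.logFunction_eq _ _ (matrixL κ₁ κ₂) (TModule.log_coeff_zero _) h]
    have hv : ∀ m, (fun j => (MvPowerSeries.X j : MvPowerSeries (Fin 4) (RatFunc F)) ^
        Fintype.card F ^ (m + 1)) =
        ![MvPowerSeries.X 0 ^ Fintype.card F ^ (m + 1),
          MvPowerSeries.X 1 ^ Fintype.card F ^ (m + 1),
          MvPowerSeries.X 2 ^ Fintype.card F ^ (m + 1),
          MvPowerSeries.X 3 ^ Fintype.card F ^ (m + 1)] := fun m => by
      funext j
      fin_cases j <;> rfl
    simp only [hv]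
  · have h := fun m => symmetricSquare_log_coeff κ₁ κ₂ hF (m + 1)
    simp only [Nat.succ_ne_zero, if_false] at h
    rw [TModule.logFunction_eq _ _ (fun m => matrixL κ₁ κ₂ m * symmetricInclusion (RatFunc F))
      (TModule.log_coeff_zero _) h]
    have hv : ∀ m, constMulVec (symmetricInclusion (RatFunc F))
        (fun j => (MvPowerSeries.X j : MvPowerSeries (Fin 3) (RatFunc F)) ^
          Fintype.card F ^ (m + 1)) =
        ![MvPowerSeries.X 0 ^ Fintype.card F ^ (m + 1),
          MvPowerSeries.X 1 ^ Fintype.card F ^ (m + 1),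
          MvPowerSeries.X 1 ^ Fintype.card F ^ (m + 1),
          MvPowerSeries.X 2 ^ Fintype.card F ^ (m + 1)] := fun m => by
      funext i
      fin_cases i <;> simp [constMulVec, symmetricInclusion, Fin.sum_univ_succ]
    simp only [constMulVec_mul, hv]
  · rw [TModule.logFunction_eq (alternatingSquare κ₂) 1
      (fun m => !![coeffL0Tilde κ₁ κ₂ (m : ℤ)]) (TModule.log_coeff_zero _) fun m => ?_]
    · simp [constMulVec_one, constMulVec]
    -- `κ₁` must be supplied: `Alt² φ` does not involve it.
    · rw [alternatingSquare_log_coeff κ₁, if_neg (Nat.succ_ne_zero m), Matrix.one_mul]
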